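/- Let $d\in\mathbb N$ and let $V_1:\mathbb R^d\to[0,\infty)$ be bounded, continuous, even, continuously differentiable on $\mathbb R^d\setminus\{0\}$, with $\|V_1\|_{L^1}=1$, $\int_{\mathbb R^d}|x|V_1(x)\,dx<\infty$, $\nabla V_1\in L^1(\mathbb R^d)$ and $|\nabla V_1(x)|\le C(1+|x|)$ for $x\neq0$ and some constant $C$. Set $W_1=V_1*V_1$. Fix $\varepsilon>0$ and $T>0$, and set $W_\varepsilon(x)=\varepsilon^{-d}W_1(x/\varepsilon)$ (no convexity of $W_\varepsilon$ is assumed). Let $\mathcal P_2(\mathbb R^d)$ be the set of Borel probability measures on $\mathbb R^d$ with finite second moment, $d_W$ the $2$-Wasserstein distance on it, and $\mathcal W_\varepsilon[\rho]=\frac12\int_{\mathbb R^d}(W_\varepsilon*\rho)\,d\rho$ for $\rho\in\mathcal P_2(\mathbb R^d)$. Let $\rho_0\in\mathcal P_2(\mathbb R^d)$ be absolutely continuous with respect to Lebesgue measure, with density in $L^2(\mathbb R^d)$. For $\tau>0$, a JKO sequence with time step $\tau$ is a sequence $(\rho_\tau^n)_{n\ge0}$ in $\mathcal P_2(\mathbb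 R^d)$ with $\rho_\tau^0=\rho_0$ and $$\rho_\tau^{n+1}\in\operatorname*{argmin}_{\rho\in\mathcal P_2(\mathbb R^d)}\Big\{\frac{d_W^2(\rho_\tau^n,\rho)}{2\tau}+\mathcal W_\varepsilon[\rho]\Big\}\qquad(n\ge0).$$ Its piecewise constant interpolation is $\rho_\tau(t)=\rho_\tau^n$ for $t\in((n-1)\tau,n\tau]$. Then: 1. $W_\varepsilon\in C^1(\mathbb R^d\setminus\{0\})$, and for every $\tau>0$ a JKO sequence with time step $\tau$ exists. 2. For every choice of JKO sequences, one for each $\tau>0$, there are an absolutely continuous curve $\tilde\rho:[0,T]\to(\mathcal P_2(\mathbb R^d),d_W)$ and time steps $\tau_k>0$, $\tau_k\to0$, such that $\rho_{\tau_k}(t)\to\tilde\rho(t)$ narrowly, uniformly in $t\in[0,T]$; that is, $\sup_{t\in[0,T]}\big|\int f\,d\rho_{\tau_k}(t)-\int f\,d\tilde\rho(t)\big|\to0$ for every bounded continuous $f:\mathbb R^d\to\mathbb R$. 3. For every choice of JKO sequences, every curve $\tilde\rho:[0,T]\to\mathcal P_2(\mathbb R^d)$ that is such a uniform narrow limit along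 some time steps $\tau_k>0$, $\tau_k\to0$, is a weak measure solution of $$\partial_t\rho=\nabla\cdot(\rho\,\nabla W_\varepsilon*\rho),\qquad \rho(0)=\rho_0,$$ on $[0,T]$: it is narrowly continuous, and for every $\varphi\in C_c^1(\mathbb R^d)$ and every $t\in[0,T]$ the integrals below exist and $$\int_{\mathbb R^d}\varphi\,d\tilde\rho_t-\int_{\mathbb R^d}\varphi\,d\rho_0=-\frac12\int_0^t\iint_{\mathbb R^{2d}}(\nabla\varphi(x)-\nabla\varphi(y))\cdot\nabla W_\varepsilon(x-y)\,d\tilde\rho_r(y)\,d\tilde\rho_r(x)\,dr.$$ -/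

import Mathlib

open MeasureTheory Set Filter Topology
open scoped BoundedContinuousFunction

noncomputable section

namespace NLIE

/-- The space `ℝ^d` with its Euclidean norm and Lebesgue measure. -/
abbrev E (d : ℕ) : Type := EuclideanSpace ℝ (Fin d)

/-- The assumption (V) on the kernel `V₁`: bounded, continuous, nonnegative, `C¹` away from the
origin, `‖V₁‖_{L¹} = 1`, even, with finite first moment, `∇V₁ ∈ L¹` and `|∇V₁(x)| ≤ C (1 + |x|)`. -/
structure KernelAssumption {d : ℕ} (V₁ : E d → ℝ) : Prop where
  continuous : Continuous V₁
  bounded : ∃ M : ℝ, ∀ x, V₁ x ≤ M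
  nonneg : ∀ x, 0 ≤ V₁ x
  contDiffOn : ContDiffOn ℝ 1 V₁ {0}ᶜ
  norm_eq_one : eLpNorm V₁ 1 volume = 1
  even : ∀ x, V₁ (-x) = V₁ x
  moment : Integrable (fun x => ‖x‖ * V₁ x) volume
  gradient_integrable : Integrable (gradient V₁) volume
  gradient_growth : ∃ C : ℝ, ∀ x, x ≠ 0 → ‖gradient V₁ x‖ ≤ C * (1 + ‖x‖)

/-- `W₁ = V₁ * V₁`. -/
def W1 {d : ℕ} (V₁ : E d → ℝ) : E d → ℝ :=
  convolution V₁ V₁ (ContinuousLinearMap.mul ℝ ℝ) volume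

/-- The interaction potential `W_ε(x) = ε^{-d} W₁(x/ε)`. -/
def Weps {d : ℕ} (V₁ : E d → ℝ) (ε : ℝ) (x : E d) : ℝ :=
  (ε ^ d)⁻¹ * W1 V₁ (ε⁻¹ • x)

/-- `P₂(ℝ^d)`: Borel probability measures with finite second moment. -/
abbrev P2 (d : ℕ) : Type :=
  {μ : ProbabilityMeasure (E d) // Integrable (fun x => ‖x‖ ^ 2) (μ : Measure (E d))}

/-- The underlying measure of an element of `P₂(ℝ^d)`. -/
abbrev P2.meas {d : ℕ} (μ : P2 d) : Measure (E d) := (μ.1 : Measure (E d))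

/-- Membership in `L²(ℝ^d)`: absolutely continuous with square integrable Lebesgue density. -/
def P2.InL2 {d : ℕ} (μ : P2 d) : Prop :=
  μ.meas ≪ volume ∧ MemLp (fun x => (μ.meas.rnDeriv volume x).toReal) 2 volume

/-- `Γ(μ, ν)`: transport plans, i.e. probability measures on the product with marginals `μ, ν`. -/
def transportPlans {d : ℕ} (μ ν : P2 d) : Set (ProbabilityMeasure (E d × E d)) :=
  {γ | (γ : Measure (E d × E d)).map Prod.fst = μ.meas ∧
    (γ : Measure (E d × E d)).map Prod.snd = ν.meas}

/-- The squared `2`-Wasserstein distance. On `P₂(ℝ^d)` every plan has finite cost and the set of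
plans is nonempty, so that this infimum of real numbers is a genuine one. -/
def wassersteinSq {d : ℕ} (μ ν : P2 d) : ℝ :=
  sInf ((fun γ : ProbabilityMeasure (E d × E d) =>
    ∫ z, ‖z.1 - z.2‖ ^ 2 ∂(γ : Measure (E d × E d))) '' transportPlans μ ν)

/-- The `2`-Wasserstein distance. -/
def wassersteinDist {d : ℕ} (μ ν : P2 d) : ℝ := Real.sqrt (wassersteinSq μ ν)

/-- The interaction energy `½ ∫ (W * ρ) dρ`. -/
def energy {d : ℕ} (W : E d → ℝ) (ρ : P2 d) : ℝ :=
  (1 / 2) * ∫ x, (∫ y, W (x - y) ∂ρ.meas) ∂ρ.meas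

/-- The penalised energy `ρ ↦ d_W²(ρ', ρ) / (2τ) + 𝒲[ρ]`. -/
def jkoFunctional {d : ℕ} (W : E d → ℝ) (τ : ℝ) (ρ' ρ : P2 d) : ℝ :=
  wassersteinSq ρ' ρ / (2 * τ) + energy W ρ

/-- A sequence produced by the JKO scheme with time step `τ` started at `ρ₀`: each element is a
minimiser over all of `P₂(ℝ^d)` of the energy penalised by the distance to its predecessor. -/
def IsJKOSequence {d : ℕ} (W : E d → ℝ) (ρ₀ : P2 d) (τ : ℝ) (r : ℕ → P2 d) : Prop :=
  r 0 = ρ₀ ∧ ∀ n, IsMinOn (jkoFunctional W τ (r n)) univ (r (n + 1))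

/-- The piecewise constant interpolation, equal to `r n` for `t ∈ ((n-1)τ, nτ]`. -/
def interpolation {d : ℕ} (τ : ℝ) (r : ℕ → P2 d) (t : ℝ) : P2 d := r ⌈t / τ⌉₊

/-- The curves `ρ_k` converge narrowly to `ρ`, uniformly in `t ∈ [0,T]`. -/
def NarrowUniformLimit {d : ℕ} (T : ℝ) (ρk : ℕ → ℝ → P2 d) (ρ : ℝ → P2 d) : Prop :=
  ∀ f : E d →ᵇ ℝ, TendstoUniformlyOn (fun k t => ∫ x, f x ∂(ρk k t).meas)
    (fun t => ∫ x, f x ∂(ρ t).meas) atTop (Icc 0 T)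

/-- `ρ` is a limit curve of the interpolations of the JKO sequences `R τ`, `τ > 0`, along some
sequence of time steps that tends to zero. -/
def IsJKOLimitCurve {d : ℕ} (T : ℝ) (R : ℝ → ℕ → P2 d) (ρ : ℝ → P2 d) : Prop :=
  ∃ τ : ℕ → ℝ, (∀ k, 0 < τ k) ∧ Tendsto τ atTop (𝓝 0) ∧
    NarrowUniformLimit T (fun k => interpolation (τ k) (R (τ k))) ρ

/-- Absolute continuity of a curve `[0,T] → (P₂(ℝ^d), d_W)`. -/
def IsACCurve {d : ℕ} (T : ℝ) (ρ : ℝ → P2 d) : Prop :=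
  ∃ m : ℝ → ℝ, IntegrableOn m (Icc 0 T) volume ∧
    ∀ s t, 0 ≤ s → s ≤ t → t ≤ T → wassersteinDist (ρ s) (ρ t) ≤ ∫ r in s..t, m r

/-- The integrand `(∇φ(x) - ∇φ(y)) · ∇W(x - y)` of the weak formulation, `z = (x, y)`. -/
def weakIntegrand {d : ℕ} (W φ : E d → ℝ) (z : E d × E d) : ℝ :=
  inner ℝ (gradient φ z.1 - gradient φ z.2) (gradient W (z.1 - z.2))

/-- Weak measure solutions of `∂ₜρ = ∇·(ρ ∇W * ρ)` on `[0,T]` with initial datum `ρ₀`: narrowly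
continuous curves in `P₂(ℝ^d)` for which, for all `φ ∈ C¹_c` and all `t ∈ [0,T]`, the integrals on
the right-hand side of the weak formulation exist and the weak formulation holds. -/
structure IsWeakMeasureSolution {d : ℕ} (W : E d → ℝ) (T : ℝ) (ρ₀ : P2 d) (ρ : ℝ → P2 d) :
    Prop where
  narrowlyContinuous : ContinuousOn (fun t => (ρ t).1) (Icc 0 T)
  integrable : ∀ φ : E d → ℝ, ContDiff ℝ 1 φ → HasCompactSupport φ → ∀ t ∈ Icc 0 T,
    Integrable (weakIntegrand W φ) ((ρ t).meas.prod (ρ t).meas)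
  intervalIntegrable : ∀ φ : E d → ℝ, ContDiff ℝ 1 φ → HasCompactSupport φ → ∀ t ∈ Icc 0 T,
    IntervalIntegrable (fun r => ∫ z, weakIntegrand W φ z ∂((ρ r).meas.prod (ρ r).meas))
      volume 0 t
  weak_form : ∀ φ : E d → ℝ, ContDiff ℝ 1 φ → HasCompactSupport φ → ∀ t ∈ Icc 0 T,
    (∫ x, φ x ∂(ρ t).meas) - ∫ x, φ x ∂ρ₀.meas =
      -(1 / 2) * ∫ r in (0 : ℝ)..t,
        ∫ z, weakIntegrand W φ z ∂((ρ r).meas.prod (ρ r).meas)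

end NLIE

end

noncomputable section

namespace NLIE

open scoped ENNReal NNReal

variable {d : ℕ}

/-! Convolution removes the singularity of the kernel at the origin. Since `V₁` is bounded and `∇V₁`
is integrable, `∇W₁ = V₁ * ∇V₁` is bounded and continuous on the whole space, so `W_ε` is a bounded,
nonnegative, globally Lipschitz `C¹` potential. Everything after `isRegularPotential_Weps` uses only
these properties, with `L` a bound on the gradient; convexity plays no role.

Each JKO step has a minimiser by the direct method, run on transport plans with fixed first marginal
and free second marginal (`exists_min_cost_add`). Comparing the minimiser with its predecessor, and
using that the energy is `L`-Lipschitz along couplings, gives `d_W ≤ 2Lτ` for one step. The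
interpolations are therefore `2L`-Lipschitz up to an error of order `τ`, and their second moments
are bounded on `[0,T]`. Prokhorov compactness together with an Arzelà–Ascoli argument in the
Lévy–Prokhorov metric yields the limit curve, which is `2L`-Lipschitz because `d_W` is narrowly
lower semicontinuous.

For the equation, the minimiser is perturbed by pushing it forward along `id + s ∇φ`. The resulting
Euler–Lagrange identity turns one step of the weak formulation into a first-order Taylor remainder
of `φ` integrated against an optimal plan (`weak_step`). Summed over the steps up to time `t`, these
remainders vanish in the limit. Since `weakIntegrand` is bounded and continuous, its integral
against `ρ ⊗ ρ` is narrowly continuous in `ρ`, and dominated convergence in time handles the drift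
term. -/

theorem norm_gradient (f : E d → ℝ) (x : E d) : ‖gradient f x‖ = ‖fderiv ℝ f x‖ := by
  simp [gradient]

/-! ### Regularity of the convolved kernel -/

namespace KernelAssumption

variable {V₁ : E d → ℝ}

theorem integrable (hV : KernelAssumption V₁) : Integrable V₁ volume := by
  refine memLp_one_iff_integrable.1 ⟨hV.continuous.aestronglyMeasurable, ?_⟩
  rw [hV.norm_eq_one]
  exact ENNReal.one_lt_top

theorem differentiableAt (hV : KernelAssumption V₁) {x : E d} (hx : x ≠ 0) :
    DifferentiableAt ℝ V₁ x :=
  (hV.contDiffOn.differentiableOn one_ne_zero).differentiableAt (isOpen_compl_singleton.mem_nhds hx)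

theorem ae_differentiableAt_sub (hV : KernelAssumption V₁) (x : E d) :
    ∀ᵐ y ∂(volume : Measure (E d)), DifferentiableAt ℝ V₁ (x - y) := by
  -- In dimension zero a point has positive measure, so the exceptional point `y = x` is not
  -- negligible; but there every function is constant.
  rcases Nat.eq_zero_or_pos d with rfl | hd
  · refine Eventually.of_forall fun y => ?_
    have : V₁ = fun _ => V₁ 0 := funext fun z => congrArg V₁ (Subsingleton.elim z 0)
    rw [this]
    exact differentiableAt_const _
  · have : Nonempty (Fin d) := ⟨⟨0, hd⟩⟩
    filter_upwards [compl_mem_ae_iff.2 (measure_singleton (μ := (volume : Measure (E d))) x)]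
      with y hy
    exact hV.differentiableAt (sub_ne_zero.2 fun h => hy h.symm)

theorem integrable_fderiv (hV : KernelAssumption V₁) :
    Integrable (fderiv ℝ V₁) (volume : Measure (E d)) :=
  hV.gradient_integrable.mono (measurable_fderiv ℝ V₁).aestronglyMeasurable
    (Eventually.of_forall fun x => (norm_gradient V₁ x).ge)

theorem exists_norm_fderiv_le (hV : KernelAssumption V₁) :
    ∃ C : ℝ, 0 ≤ C ∧ ∀ x, x ≠ 0 → ‖fderiv ℝ V₁ x‖ ≤ C * (1 + ‖x‖) := by
  obtain ⟨C₀, hC₀⟩ := hV.gradient_growth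
  refine ⟨max C₀ 0, le_max_right _ _, fun x hx => ?_⟩
  rw [← norm_gradient]
  exact (hC₀ x hx).trans (mul_le_mul_of_nonneg_right (le_max_left _ _) (by positivity))

/-- The mean value inequality applies on segments that avoid the origin. Continuity of `V₁` extends
it to segments ending at the origin, by approaching along `t • a`. A segment through the origin is
split there, with no loss since then `‖a‖ + ‖b‖ = ‖a - b‖`. -/
theorem exists_locally_lipschitz (hV : KernelAssumption V₁) :
    ∃ C : ℝ, 0 ≤ C ∧ ∀ a b, ‖V₁ a - V₁ b‖ ≤ C * (1 + ‖a‖ + ‖b‖) * ‖a - b‖ := by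
  obtain ⟨C, hC, hgrad⟩ := hV.exists_norm_fderiv_le
  have off : ∀ a b : E d, (0 : E d) ∉ segment ℝ a b →
      ‖V₁ a - V₁ b‖ ≤ C * (1 + ‖a‖ + ‖b‖) * ‖a - b‖ := by
    intro a b h0
    refine Convex.norm_image_sub_le_of_norm_fderiv_le (𝕜 := ℝ) (s := segment ℝ a b)
      (fun x hx => hV.differentiableAt fun h => h0 (h ▸ hx)) (fun x hx => ?_)
      (convex_segment a b) (right_mem_segment ℝ a b) (left_mem_segment ℝ a b)
    have hx' : ‖x‖ ≤ ‖a‖ + ‖b‖ := by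
      have : segment ℝ a b ⊆ Metric.closedBall 0 (‖a‖ + ‖b‖) :=
        (convex_closedBall _ _).segment_subset (by simp) (by simp)
      simpa using this hx
    refine (hgrad x fun h => h0 (h ▸ hx)).trans (mul_le_mul_of_nonneg_left ?_ hC)
    linarith
  have zero : ∀ a : E d, ‖V₁ a - V₁ 0‖ ≤ C * (1 + ‖a‖) * ‖a‖ := by
    intro a
    rcases eq_or_ne a 0 with rfl | ha
    · simp
    have hlim1 : Tendsto (fun t : ℝ => ‖V₁ a - V₁ (t • a)‖) (𝓝[>] 0) (𝓝 ‖V₁ a - V₁ 0‖) := by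
      have : Continuous fun t : ℝ => ‖V₁ a - V₁ (t • a)‖ := by
        have := hV.continuous
        fun_prop
      simpa using (this.tendsto 0).mono_left nhdsWithin_le_nhds
    have hlim2 : Tendsto (fun t : ℝ => C * (1 + ‖a‖ + ‖t • a‖) * ‖a - t • a‖) (𝓝[>] 0)
        (𝓝 (C * (1 + ‖a‖) * ‖a‖)) := by
      have : Continuous fun t : ℝ => C * (1 + ‖a‖ + ‖t • a‖) * ‖a - t • a‖ := by fun_prop
      simpa using (this.tendsto 0).mono_left nhdsWithin_le_nhds
    refine le_of_tendsto_of_tendsto hlim1 hlim2 ?_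
    filter_upwards [self_mem_nhdsWithin] with t ht
    refine off a (t • a) ?_
    rintro ⟨u, v, hu, hv, huv, h⟩
    rw [smul_smul, ← add_smul] at h
    rcases smul_eq_zero.1 h with h | h
    · have ht' : (0 : ℝ) < t := ht
      rcases hu.eq_or_lt with hu' | hu'
      · have : v = 1 := by linarith
        subst this
        linarith
      · have := mul_nonneg hv ht'.le
        linarith
    · exact ha h
  refine ⟨C, hC, fun a b => ?_⟩
  by_cases h0 : (0 : E d) ∈ segment ℝ a b
  · have hd : ‖a‖ + ‖b‖ = ‖a - b‖ := by
      have := (mem_segment_iff_wbtw.1 h0).dist_add_dist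
      rwa [dist_zero_right, dist_zero_left, dist_eq_norm] at this
    calc ‖V₁ a - V₁ b‖ ≤ ‖V₁ a - V₁ 0‖ + ‖V₁ b - V₁ 0‖ := by
          rw [norm_sub_rev (V₁ b)]
          exact norm_sub_le_norm_sub_add_norm_sub _ _ _
      _ ≤ C * (1 + ‖a‖) * ‖a‖ + C * (1 + ‖b‖) * ‖b‖ := add_le_add (zero a) (zero b)
      _ ≤ C * (1 + ‖a‖ + ‖b‖) * (‖a‖ + ‖b‖) := by
          have := mul_nonneg hC (mul_nonneg (norm_nonneg a) (norm_nonneg b))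
          nlinarith
      _ = _ := by rw [hd]
  · exact off a b h0

theorem W1_apply (x : E d) : W1 V₁ x = ∫ y, V₁ y * V₁ (x - y) := by
  simp [W1, convolution]

theorem integrable_mul_sub (hV : KernelAssumption V₁) (x : E d) :
    Integrable (fun y => V₁ y * V₁ (x - y)) := by
  obtain ⟨M, hM⟩ := hV.bounded
  have hc := hV.continuous
  refine (hV.integrable.mul_const M).mono' (by fun_prop) (Eventually.of_forall fun y => ?_)
  rw [Real.norm_of_nonneg (mul_nonneg (hV.nonneg _) (hV.nonneg _))]
  exact mul_le_mul_of_nonneg_left (hM _) (hV.nonneg _)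

/-- Differentiation under the integral is done in the form `∫ V₁(y) V₁(x - y) dy`: the Lipschitz
constant of `V₁(· - y)` near `x` grows linearly in `‖y‖`, which the first moment of `V₁` absorbs.
The substitution `z = x - y` then leaves the derivative at a point independent of `x`, the form in
which boundedness and continuity in `x` follow from `∇V₁ ∈ L¹`. -/
theorem hasFDerivAt_W1 (hV : KernelAssumption V₁) (x : E d) :
    HasFDerivAt (W1 V₁) (∫ z, V₁ (x - z) • fderiv ℝ V₁ z) x := by
  obtain ⟨C, hC, hlip⟩ := hV.exists_locally_lipschitz
  have hc := hV.continuous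
  have key := (hasFDerivAt_integral_of_dominated_loc_of_lip (μ := (volume : Measure (E d)))
    (F := fun x y => V₁ y * V₁ (x - y)) (x₀ := x) (s := Metric.ball x 1)
    (F' := fun y => V₁ y • fderiv ℝ V₁ (x - y))
    (bound := fun y => C * (1 + 2 * (‖x‖ + 1)) * V₁ y + C * 2 * (‖y‖ * V₁ y))
    (Metric.ball_mem_nhds x one_pos)
    (Eventually.of_forall fun x' => (hV.integrable_mul_sub x').aestronglyMeasurable)
    (hV.integrable_mul_sub x) ?_ ?_ ?_ ?_).2
  · have h2 : ∫ y, V₁ y • fderiv ℝ V₁ (x - y) = ∫ z, V₁ (x - z) • fderiv ℝ V₁ z := by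
      rw [← integral_sub_left_eq_self (fun y => V₁ y • fderiv ℝ V₁ (x - y)) volume x]
      simp
    rw [h2] at key
    exact key.congr_of_eventuallyEq (Eventually.of_forall fun x' => W1_apply x')
  · exact (hc.measurable.smul
      ((measurable_fderiv ℝ V₁).comp (measurable_const.sub measurable_id))).aestronglyMeasurable
  · refine Eventually.of_forall fun y => LipschitzOnWith.of_dist_le_mul fun a ha b hb => ?_
    have hVy := hV.nonneg y
    rw [Real.dist_eq, dist_eq_norm, ← mul_sub, abs_mul, abs_of_nonneg hVy, Real.coe_nnabs]
    have hxa : ‖a‖ ≤ ‖x‖ + 1 := by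
      have := norm_le_norm_add_norm_sub x a
      rw [norm_sub_rev, ← dist_eq_norm] at this
      have := Metric.mem_ball.1 ha
      linarith
    have hxb : ‖b‖ ≤ ‖x‖ + 1 := by
      have := norm_le_norm_add_norm_sub x b
      rw [norm_sub_rev, ← dist_eq_norm] at this
      have := Metric.mem_ball.1 hb
      linarith
    have h1 := hlip (a - y) (b - y)
    rw [sub_sub_sub_cancel_right, Real.norm_eq_abs] at h1
    have h2 : 1 + ‖a - y‖ + ‖b - y‖ ≤ 1 + 2 * (‖x‖ + 1) + 2 * ‖y‖ := by
      have := norm_sub_le a y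
      have := norm_sub_le b y
      linarith
    calc V₁ y * |V₁ (a - y) - V₁ (b - y)|
        ≤ V₁ y * (C * (1 + 2 * (‖x‖ + 1) + 2 * ‖y‖) * ‖a - b‖) := by
          refine mul_le_mul_of_nonneg_left (h1.trans ?_) hVy
          gcongr
      _ = (C * (1 + 2 * (‖x‖ + 1)) * V₁ y + C * 2 * (‖y‖ * V₁ y)) * ‖a - b‖ := by ring
      _ ≤ _ := mul_le_mul_of_nonneg_right (le_abs_self _) (norm_nonneg _)
  · exact (hV.integrable.const_mul _).add (hV.moment.const_mul _)
  · filter_upwards [hV.ae_differentiableAt_sub x] with y hy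
    exact (hy.hasFDerivAt.comp x ((hasFDerivAt_id x).sub_const y)).const_mul (V₁ y)

theorem exists_norm_fderiv_W1_le (hV : KernelAssumption V₁) :
    ∃ L : ℝ, ∀ x, ‖fderiv ℝ (W1 V₁) x‖ ≤ L := by
  obtain ⟨M, hM⟩ := hV.bounded
  refine ⟨∫ z, M * ‖fderiv ℝ V₁ z‖, fun x => ?_⟩
  rw [(hV.hasFDerivAt_W1 x).fderiv]
  refine norm_integral_le_of_norm_le (hV.integrable_fderiv.norm.const_mul M)
    (Eventually.of_forall fun z => ?_)
  rw [norm_smul, Real.norm_of_nonneg (hV.nonneg _)]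
  exact mul_le_mul_of_nonneg_right (hM _) (norm_nonneg _)

theorem contDiff_W1 (hV : KernelAssumption V₁) : ContDiff ℝ 1 (W1 V₁) := by
  obtain ⟨M, hM⟩ := hV.bounded
  have hc := hV.continuous
  refine contDiff_one_iff_hasFDerivAt.2 ⟨_, ?_, hV.hasFDerivAt_W1⟩
  refine continuous_of_dominated (bound := fun z => M * ‖fderiv ℝ V₁ z‖) (fun x => ?_)
    (fun x => Eventually.of_forall fun z => ?_) (hV.integrable_fderiv.norm.const_mul M)
    (Eventually.of_forall fun z => by fun_prop)
  · exact (Measurable.smul (hc.measurable.comp (measurable_const.sub measurable_id))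
      (measurable_fderiv ℝ V₁)).aestronglyMeasurable
  · rw [norm_smul, Real.norm_of_nonneg (hV.nonneg _)]
    exact mul_le_mul_of_nonneg_right (hM _) (norm_nonneg _)

theorem W1_nonneg (hV : KernelAssumption V₁) (x : E d) : 0 ≤ W1 V₁ x := by
  rw [W1_apply]
  exact integral_nonneg fun y => mul_nonneg (hV.nonneg _) (hV.nonneg _)

theorem exists_W1_le (hV : KernelAssumption V₁) : ∃ B : ℝ, ∀ x, W1 V₁ x ≤ B := by
  obtain ⟨M, hM⟩ := hV.bounded
  refine ⟨∫ y, V₁ y * M, fun x => ?_⟩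
  rw [W1_apply]
  exact integral_mono (hV.integrable_mul_sub x) (hV.integrable.mul_const M)
    fun y => mul_le_mul_of_nonneg_left (hM _) (hV.nonneg _)

end KernelAssumption

/-- Nonnegative bounded `C¹` potentials with bounded gradient. -/
structure IsRegularPotential (W : E d → ℝ) (B L : ℝ) : Prop where
  contDiff : ContDiff ℝ 1 W
  nonneg : ∀ x, 0 ≤ W x
  le : ∀ x, W x ≤ B
  norm_fderiv_le : ∀ x, ‖fderiv ℝ W x‖ ≤ L

theorem KernelAssumption.isRegularPotential_Weps {V₁ : E d → ℝ} (hV : KernelAssumption V₁)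
    {ε : ℝ} (hε : 0 < ε) : ∃ B L : ℝ, IsRegularPotential (Weps V₁ ε) B L := by
  obtain ⟨B, hB⟩ := hV.exists_W1_le
  obtain ⟨L, hL⟩ := hV.exists_norm_fderiv_W1_le
  have hW := hV.contDiff_W1
  have hε' : 0 ≤ (ε ^ d)⁻¹ := by positivity
  refine ⟨(ε ^ d)⁻¹ * B, (ε ^ d)⁻¹ * (ε⁻¹ * L), ?_, fun x => ?_, fun x => ?_, fun x => ?_⟩
  · unfold Weps
    fun_prop
  · exact mul_nonneg hε' (hV.W1_nonneg _)
  · exact mul_le_mul_of_nonneg_left (hB _) hε'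
  · have h1 : fderiv ℝ (Weps V₁ ε) x = (ε ^ d)⁻¹ • (ε⁻¹ • fderiv ℝ (W1 V₁) (ε⁻¹ • x)) := by
      have h := (hW.differentiable one_ne_zero (ε⁻¹ • x)).hasFDerivAt.comp x
        ((hasFDerivAt_id (𝕜 := ℝ) x).const_smul ε⁻¹)
      have h' := (h.const_mul (ε ^ d)⁻¹).fderiv
      refine Eq.trans h' ?_
      ext v
      simp
    rw [h1, norm_smul, norm_smul, Real.norm_of_nonneg hε', Real.norm_of_nonneg (by positivity)]
    gcongr
    exact hL _

/-! ### Narrow topology: semicontinuity, compactness and continuity of integrals -/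

section Narrow

variable {X : Type*} [MeasurableSpace X]

/-- By monotone convergence the integral is the supremum over `n` of the integrals of the bounded
truncations `min f n`, each narrowly continuous. -/
theorem lowerSemicontinuous_lintegral_ofReal [TopologicalSpace X] [OpensMeasurableSpace X]
    {f : X → ℝ} (hf : Continuous f) :
    LowerSemicontinuous fun μ : ProbabilityMeasure X =>
      ∫⁻ x, ENNReal.ofReal (f x) ∂(μ : Measure X) := by
  have h : ∀ μ : ProbabilityMeasure X, ∫⁻ x, ENNReal.ofReal (f x) ∂(μ : Measure X) =
      ⨆ n : ℕ, ∫⁻ x, ENNReal.ofReal (min (f x) n) ∂(μ : Measure X) := by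
    intro μ
    rw [← lintegral_iSup]
    · refine lintegral_congr fun x => le_antisymm ?_ (iSup_le fun n =>
        ENNReal.ofReal_le_ofReal (min_le_left _ _))
      obtain ⟨n, hn⟩ := exists_nat_ge (f x)
      exact le_iSup_of_le n (by rw [min_eq_left hn])
    · exact fun n => (ENNReal.continuous_ofReal.comp (hf.min continuous_const)).measurable
    · exact fun m n hmn x => ENNReal.ofReal_le_ofReal (min_le_min le_rfl (Nat.cast_le.2 hmn))
  simp_rw [h]
  refine lowerSemicontinuous_iSup fun n => Continuous.lowerSemicontinuous ?_
  let g : X →ᵇ ℝ≥0 := BoundedContinuousFunction.mkOfBound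
    ⟨fun x => Real.toNNReal (min (f x) n), continuous_real_toNNReal.comp (hf.min continuous_const)⟩
    n fun x y => by
      have hb : ∀ z, Real.toNNReal (min (f z) n) ∈ Icc (0 : ℝ≥0) n := fun z =>
        ⟨zero_le, Real.toNNReal_le_iff_le_coe.2 (min_le_right _ _)⟩
      rw [NNReal.dist_eq, abs_sub_le_iff]
      have h1 : ((Real.toNNReal (min (f x) n) : ℝ≥0) : ℝ) ≤ n := by exact_mod_cast (hb x).2
      have h2 : ((Real.toNNReal (min (f y) n) : ℝ≥0) : ℝ) ≤ n := by exact_mod_cast (hb y).2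
      have h3 := (Real.toNNReal (min (f x) n)).coe_nonneg
      have h4 := (Real.toNNReal (min (f y) n)).coe_nonneg
      exact ⟨by simp only [ContinuousMap.coe_mk]; linarith,
        by simp only [ContinuousMap.coe_mk]; linarith⟩
  exact ProbabilityMeasure.continuous_lintegral_boundedContinuousFunction g

theorem isClosed_setOf_lintegral_ofReal_le [TopologicalSpace X] [OpensMeasurableSpace X]
    {f : X → ℝ} (hf : Continuous f) (M : ℝ≥0∞) :
    IsClosed {μ : ProbabilityMeasure X | ∫⁻ x, ENNReal.ofReal (f x) ∂(μ : Measure X) ≤ M} :=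
  (lowerSemicontinuous_lintegral_ofReal hf).isClosed_preimage M

/-- Markov's inequality bounds the mass outside a ball of radius `r` by `M / r²`, so the set is
tight; it is closed by lower semicontinuity, and Prokhorov's theorem applies. -/
theorem isCompact_setOf_lintegral_norm_sq_le [NormedAddCommGroup X] [ProperSpace X] [BorelSpace X]
    {M : ℝ≥0∞} (hM : M ≠ ∞) : IsCompact {μ : ProbabilityMeasure X |
      ∫⁻ x, ENNReal.ofReal (‖x‖ ^ 2) ∂(μ : Measure X) ≤ M} := by
  have hf : Continuous fun x : X => ‖x‖ ^ 2 := by fun_prop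
  rw [← (isClosed_setOf_lintegral_ofReal_le hf M).closure_eq]
  refine isCompact_closure_of_isTightMeasureSet (isTightMeasureSet_of_tendsto_measure_norm_gt ?_)
  have hlim : Tendsto (fun r : ℝ => M * ENNReal.ofReal ((r ^ 2)⁻¹)) atTop (𝓝 0) := by
    have h1 : Tendsto (fun r : ℝ => (r ^ 2)⁻¹) atTop (𝓝 0) :=
      tendsto_inv_atTop_zero.comp (tendsto_pow_atTop two_ne_zero)
    have h2 := ENNReal.Tendsto.const_mul (a := M) (ENNReal.tendsto_ofReal h1) (Or.inr hM)
    simpa using h2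
  refine tendsto_of_tendsto_of_tendsto_of_le_of_le' tendsto_const_nhds hlim
    (Eventually.of_forall fun _ => zero_le) ?_
  filter_upwards [eventually_gt_atTop 0] with r hr
  refine iSup₂_le ?_
  rintro _ ⟨μ, hμ, rfl⟩
  have hr2 : ENNReal.ofReal (r ^ 2) ≠ 0 := by
    simpa using hr.ne'
  rw [ENNReal.ofReal_inv_of_pos (pow_pos hr 2), ← div_eq_mul_inv,
    ENNReal.le_div_iff_mul_le (Or.inl hr2) (Or.inl ENNReal.ofReal_ne_top), mul_comm]
  refine (mul_le_mul_right ?_ _).trans ((mul_meas_ge_le_lintegral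
    (ENNReal.continuous_ofReal.comp (continuous_norm.pow 2)).measurable
      (ENNReal.ofReal (r ^ 2))).trans hμ)
  refine measure_mono fun x hx => ENNReal.ofReal_le_ofReal ?_
  exact pow_le_pow_left₀ hr.le (le_of_lt hx) 2

theorem continuous_integral_of_bounded [TopologicalSpace X] [OpensMeasurableSpace X]
    {g : X → ℝ} (hg : Continuous g) {C : ℝ} (hC : ∀ x, ‖g x‖ ≤ C) :
    Continuous fun μ : ProbabilityMeasure X => ∫ x, g x ∂(μ : Measure X) :=
  ProbabilityMeasure.continuous_integral_boundedContinuousFunction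
    (BoundedContinuousFunction.ofNormedAddCommGroup g hg C hC)

theorem integrable_of_bounded [TopologicalSpace X] [OpensMeasurableSpace X]
    [SecondCountableTopology X] {F : Type*}
    [NormedAddCommGroup F] {g : X → F} (hg : Continuous g) {C : ℝ} (hC : ∀ x, ‖g x‖ ≤ C)
    (μ : Measure X) [IsFiniteMeasure μ] : Integrable g μ :=
  (integrable_const C).mono' hg.aestronglyMeasurable (Eventually.of_forall hC)

theorem continuous_integral_prod_self_of_bounded [TopologicalSpace X] [OpensMeasurableSpace X]
    [SecondCountableTopology X] [TopologicalSpace.PseudoMetrizableSpace X]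
    {g : X × X → ℝ} (hg : Continuous g) {C : ℝ} (hC : ∀ x, ‖g x‖ ≤ C) :
    Continuous fun μ : ProbabilityMeasure X => ∫ z, g z ∂((μ : Measure X).prod (μ : Measure X)) := by
  have h := ProbabilityMeasure.continuous_prod (α := X) (β := X)
  exact (continuous_integral_of_bounded hg hC).comp (h.comp (continuous_id.prodMk continuous_id))

end Narrow

/-! ### Transport plans and optimal couplings -/

section Plans

variable {μ ν : P2 d} {γ : ProbabilityMeasure (E d × E d)}

theorem isClosed_setOf_map_fst_eq (μ : Measure (E d)) [IsProbabilityMeasure μ] :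
    IsClosed {γ : ProbabilityMeasure (E d × E d) |
      (γ : Measure (E d × E d)).map Prod.fst = μ} := by
  let m : ProbabilityMeasure (E d) := ⟨μ, inferInstance⟩
  have h := (isClosed_singleton (x := m)).preimage
    (ProbabilityMeasure.continuous_map (continuous_fst (X := E d) (Y := E d)))
  convert h using 1
  ext γ
  rw [mem_preimage, mem_singleton_iff, ← ProbabilityMeasure.toMeasure_injective.eq_iff,
    ProbabilityMeasure.toMeasure_map]
  rfl

theorem isClosed_setOf_map_snd_eq (μ : Measure (E d)) [IsProbabilityMeasure μ] :
    IsClosed {γ : ProbabilityMeasure (E d × E d) |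
      (γ : Measure (E d × E d)).map Prod.snd = μ} := by
  let m : ProbabilityMeasure (E d) := ⟨μ, inferInstance⟩
  have h := (isClosed_singleton (x := m)).preimage
    (ProbabilityMeasure.continuous_map (continuous_snd (X := E d) (Y := E d)))
  convert h using 1
  ext γ
  rw [mem_preimage, mem_singleton_iff, ← ProbabilityMeasure.toMeasure_injective.eq_iff,
    ProbabilityMeasure.toMeasure_map]
  rfl

theorem isClosed_transportPlans (μ ν : P2 d) : IsClosed (transportPlans μ ν) :=
  (isClosed_setOf_map_fst_eq μ.meas).inter (isClosed_setOf_map_snd_eq ν.meas)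

theorem prod_mem_transportPlans (μ ν : P2 d) : μ.1.prod ν.1 ∈ transportPlans μ ν := by
  constructor <;> simp

theorem integral_fst_of_mem (hγ : γ ∈ transportPlans μ ν) {F : Type*} [NormedAddCommGroup F]
    [NormedSpace ℝ F] {f : E d → F} (hf : StronglyMeasurable f) :
    ∫ z, f z.1 ∂(γ : Measure (E d × E d)) = ∫ x, f x ∂μ.meas := by
  rw [← hγ.1, integral_map measurable_fst.aemeasurable hf.aestronglyMeasurable]

theorem integral_snd_of_mem (hγ : γ ∈ transportPlans μ ν) {F : Type*} [NormedAddCommGroup F]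
    [NormedSpace ℝ F] {f : E d → F} (hf : StronglyMeasurable f) :
    ∫ z, f z.2 ∂(γ : Measure (E d × E d)) = ∫ x, f x ∂ν.meas := by
  rw [← hγ.2, integral_map measurable_snd.aemeasurable hf.aestronglyMeasurable]

theorem integrable_fst_sq (hγ : γ ∈ transportPlans μ ν) :
    Integrable (fun z : E d × E d => ‖z.1‖ ^ 2) (γ : Measure (E d × E d)) := by
  have h := μ.2
  change Integrable _ μ.meas at h
  rw [← hγ.1] at h
  exact (integrable_map_measure (by fun_prop) measurable_fst.aemeasurable).1 h

theorem integrable_snd_sq (hγ : γ ∈ transportPlans μ ν) :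
    Integrable (fun z : E d × E d => ‖z.2‖ ^ 2) (γ : Measure (E d × E d)) := by
  have h := ν.2
  change Integrable _ ν.meas at h
  rw [← hγ.2] at h
  exact (integrable_map_measure (by fun_prop) measurable_snd.aemeasurable).1 h

theorem norm_sub_sq_le_two_mul {F : Type*} [SeminormedAddCommGroup F] (x y : F) :
    ‖x - y‖ ^ 2 ≤ 2 * ‖x‖ ^ 2 + 2 * ‖y‖ ^ 2 := by
  have h := norm_sub_le x y
  have h0 := norm_nonneg (x - y)
  nlinarith [sq_nonneg (‖x‖ - ‖y‖)]

theorem integrable_cost (hγ : γ ∈ transportPlans μ ν) :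
    Integrable (fun z : E d × E d => ‖z.1 - z.2‖ ^ 2) (γ : Measure (E d × E d)) := by
  refine (((integrable_fst_sq hγ).const_mul 2).add ((integrable_snd_sq hγ).const_mul 2)).mono'
    (by fun_prop) (Eventually.of_forall fun z => ?_)
  rw [Real.norm_of_nonneg (by positivity)]
  exact norm_sub_sq_le_two_mul _ _

theorem wassersteinSq_le (hγ : γ ∈ transportPlans μ ν) :
    wassersteinSq μ ν ≤ ∫ z, ‖z.1 - z.2‖ ^ 2 ∂(γ : Measure (E d × E d)) := by
  refine csInf_le ⟨0, ?_⟩ ⟨γ, hγ, rfl⟩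
  rintro _ ⟨γ', -, rfl⟩
  exact integral_nonneg fun z => by positivity

theorem le_wassersteinSq {c : ℝ} (h : ∀ γ ∈ transportPlans μ ν,
    c ≤ ∫ z, ‖z.1 - z.2‖ ^ 2 ∂(γ : Measure (E d × E d))) : c ≤ wassersteinSq μ ν := by
  refine le_csInf ⟨_, _, prod_mem_transportPlans μ ν, rfl⟩ ?_
  rintro _ ⟨γ, hγ, rfl⟩
  exact h γ hγ

theorem wassersteinSq_nonneg (μ ν : P2 d) : 0 ≤ wassersteinSq μ ν :=
  le_wassersteinSq fun _ _ => integral_nonneg fun z => by positivity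

/-- Among the plans in a closed class with prescribed first marginal, a quadratic transport cost
plus a continuous nonnegative functional attains its minimum. -/
theorem exists_min_cost_add (μ : P2 d) {K : Set (ProbabilityMeasure (E d × E d))}
    (hK : IsClosed K) (hKμ : ∀ γ ∈ K, (γ : Measure (E d × E d)).map Prod.fst = μ.meas)
    {G : ProbabilityMeasure (E d × E d) → ℝ} (hG : Continuous G)
    {c : ℝ} (hc : 0 < c) {γ₀ : ProbabilityMeasure (E d × E d)} (hγ₀ : γ₀ ∈ K)
    (hγ₀' : Integrable (fun z : E d × E d => ‖z.1 - z.2‖ ^ 2) (γ₀ : Measure (E d × E d))) :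
    ∃ γ ∈ K, ∫⁻ z, ENNReal.ofReal (c * ‖z.1 - z.2‖ ^ 2) ∂(γ : Measure (E d × E d)) ≠ ∞ ∧
      ∀ γ' ∈ K,
      ∫⁻ z, ENNReal.ofReal (c * ‖z.1 - z.2‖ ^ 2) ∂(γ : Measure (E d × E d)) + ENNReal.ofReal (G γ) ≤
      ∫⁻ z, ENNReal.ofReal (c * ‖z.1 - z.2‖ ^ 2) ∂(γ' : Measure (E d × E d)) +
        ENNReal.ofReal (G γ') := by
  set F : ProbabilityMeasure (E d × E d) → ℝ≥0∞ := fun γ =>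
    ∫⁻ z, ENNReal.ofReal (c * ‖z.1 - z.2‖ ^ 2) ∂(γ : Measure (E d × E d)) +
      ENNReal.ofReal (G γ) with hF
  have hlsc : LowerSemicontinuous F :=
    (lowerSemicontinuous_lintegral_ofReal (by fun_prop)).add
      (ENNReal.continuous_ofReal.comp hG).lowerSemicontinuous
  have hfin : F γ₀ ≠ ∞ :=
    ENNReal.add_ne_top.2 ⟨(hγ₀'.const_mul c).lintegral_lt_top.ne, ENNReal.ofReal_ne_top⟩
  have hS : IsCompact (K ∩ {γ | F γ ≤ F γ₀}) := by
    -- The sublevel set lies in a second-moment ball because `‖z.1‖²` and `‖z.2‖²` are both at most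
    -- `2‖z.1‖² + 2‖z.1 - z.2‖²`: the first term is fixed by the marginal, the second is controlled
    -- by `F`. The factor `2 / c` undoes the weight `c` in the cost.
    have hM : ENNReal.ofReal 2 * (∫⁻ x, ENNReal.ofReal (‖x‖ ^ 2) ∂μ.meas) +
        ENNReal.ofReal (2 / c) * F γ₀ ≠ ∞ := by
      refine ENNReal.add_ne_top.2 ⟨ENNReal.mul_ne_top ENNReal.ofReal_ne_top μ.2.lintegral_lt_top.ne,
        ENNReal.mul_ne_top ENNReal.ofReal_ne_top hfin⟩
    refine (isCompact_setOf_lintegral_norm_sq_le hM).of_isClosed_subset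
      (hK.inter (hlsc.isClosed_preimage _)) ?_
    rintro γ ⟨hγK, hγ⟩
    have h1 : ∫⁻ z : E d × E d, ENNReal.ofReal (‖z‖ ^ 2) ∂(γ : Measure (E d × E d)) ≤
        ∫⁻ z : E d × E d, (ENNReal.ofReal 2 * ENNReal.ofReal (‖z.1‖ ^ 2) +
          ENNReal.ofReal (2 / c) * ENNReal.ofReal (c * ‖z.1 - z.2‖ ^ 2))
            ∂(γ : Measure (E d × E d)) := by
      refine lintegral_mono fun z => ?_
      rw [← ENNReal.ofReal_mul (by positivity), ← ENNReal.ofReal_mul (by positivity),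
        ← ENNReal.ofReal_add (by positivity) (by positivity)]
      refine ENNReal.ofReal_le_ofReal ?_
      have h2 : 2 / c * (c * ‖z.1 - z.2‖ ^ 2) = 2 * ‖z.1 - z.2‖ ^ 2 := by
        field_simp
      rw [h2]
      rcases max_cases ‖z.1‖ ‖z.2‖ with ⟨h, -⟩ | ⟨h, -⟩
      · rw [Prod.norm_def, h]
        nlinarith [sq_nonneg ‖z.1‖, sq_nonneg ‖z.1 - z.2‖]
      · rw [Prod.norm_def, h]
        have := norm_sub_sq_le_two_mul z.1 (z.1 - z.2)
        rwa [sub_sub_cancel] at this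
    refine h1.trans ?_
    rw [lintegral_add_left (by fun_prop), lintegral_const_mul _ (by fun_prop),
      lintegral_const_mul _ (by fun_prop)]
    gcongr
    · rw [← hKμ γ hγK, lintegral_map (by fun_prop) measurable_fst]
    · exact le_self_add.trans hγ
  have hne : (K ∩ {γ | F γ ≤ F γ₀}).Nonempty := ⟨γ₀, hγ₀, le_refl (F γ₀)⟩
  obtain ⟨γ, ⟨hγK, hγ⟩, hmin⟩ := LowerSemicontinuousOn.exists_isMinOn hne hS
    (hlsc.lowerSemicontinuousOn _)
  refine ⟨γ, hγK, ne_top_of_le_ne_top hfin (le_self_add.trans hγ), fun γ' hγ' => ?_⟩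
  by_cases h : F γ' ≤ F γ₀
  · exact hmin ⟨hγ', h⟩
  · exact hγ.trans (not_le.1 h).le

theorem lintegral_cost_eq (hγ : γ ∈ transportPlans μ ν) {c : ℝ} (hc : 0 ≤ c) :
    ∫⁻ z, ENNReal.ofReal (c * ‖z.1 - z.2‖ ^ 2) ∂(γ : Measure (E d × E d)) =
      ENNReal.ofReal (c * ∫ z, ‖z.1 - z.2‖ ^ 2 ∂(γ : Measure (E d × E d))) := by
  rw [← integral_const_mul, ofReal_integral_eq_lintegral_ofReal ((integrable_cost hγ).const_mul c)
    (Eventually.of_forall fun z => by positivity)]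

theorem exists_optimal_plan (μ ν : P2 d) : ∃ γ ∈ transportPlans μ ν,
    ∫ z, ‖z.1 - z.2‖ ^ 2 ∂(γ : Measure (E d × E d)) = wassersteinSq μ ν := by
  obtain ⟨γ, hγ, -, hmin⟩ := exists_min_cost_add μ (isClosed_transportPlans μ ν)
    (fun γ hγ => hγ.1) (G := fun _ => 0) continuous_const one_pos (prod_mem_transportPlans μ ν)
    (integrable_cost (prod_mem_transportPlans μ ν))
  refine ⟨γ, hγ, le_antisymm (le_wassersteinSq fun γ' hγ' => ?_) (wassersteinSq_le hγ)⟩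
  have h := hmin γ' hγ'
  rw [lintegral_cost_eq hγ zero_le_one, lintegral_cost_eq hγ' zero_le_one] at h
  simpa [ENNReal.ofReal_le_ofReal_iff (integral_nonneg fun z : E d × E d =>
    sq_nonneg ‖z.1 - z.2‖)] using h

/-- The second marginal of a plan of finite cost whose first marginal has finite second moment. -/
theorem exists_mem_transportPlans (μ : P2 d) (γ : ProbabilityMeasure (E d × E d))
    (hγ : (γ : Measure (E d × E d)).map Prod.fst = μ.meas)
    (hc : Integrable (fun z : E d × E d => ‖z.1 - z.2‖ ^ 2) (γ : Measure (E d × E d))) :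
    ∃ ν : P2 d, ν.1 = γ.map measurable_snd.aemeasurable ∧ γ ∈ transportPlans μ ν := by
  have h1 : Integrable (fun z : E d × E d => ‖z.1‖ ^ 2) (γ : Measure (E d × E d)) := by
    have h := μ.2
    change Integrable _ μ.meas at h
    rw [← hγ] at h
    exact (integrable_map_measure (by fun_prop) measurable_fst.aemeasurable).1 h
  have h2 : Integrable (fun x : E d => ‖x‖ ^ 2)
      ((γ.map measurable_snd.aemeasurable : ProbabilityMeasure (E d)) : Measure (E d)) := by
    rw [ProbabilityMeasure.toMeasure_map, integrable_map_measure (by fun_prop) (by fun_prop)]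
    refine ((h1.const_mul 2).add (hc.const_mul 2)).mono' (by fun_prop)
      (Eventually.of_forall fun z => ?_)
    rw [Function.comp_apply, Real.norm_of_nonneg (by positivity)]
    have := norm_sub_sq_le_two_mul z.1 (z.1 - z.2)
    rwa [sub_sub_cancel] at this
  exact ⟨⟨_, h2⟩, rfl, hγ, by simp [P2.meas]⟩

end Plans

/-! ### Existence of JKO minimisers -/

section Energy

variable {W : E d → ℝ} {B L : ℝ}

namespace IsRegularPotential

theorem continuous (hW : IsRegularPotential W B L) : Continuous W := hW.contDiff.continuous

theorem norm_le (hW : IsRegularPotential W B L) (x : E d) : ‖W x‖ ≤ B := by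
  rw [Real.norm_of_nonneg (hW.nonneg x)]
  exact hW.le x

theorem integrable_sub (hW : IsRegularPotential W B L) (μ : Measure (E d × E d))
    [IsFiniteMeasure μ] : Integrable (fun z : E d × E d => W (z.1 - z.2)) μ :=
  integrable_of_bounded (hW.continuous.comp (continuous_fst.sub continuous_snd))
    (fun _ => hW.norm_le _) μ

theorem energy_eq (hW : IsRegularPotential W B L) (ρ : P2 d) :
    energy W ρ = 1 / 2 * ∫ z, W (z.1 - z.2) ∂(ρ.meas.prod ρ.meas) := by
  rw [energy, integral_prod _ (hW.integrable_sub _)]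

theorem energy_nonneg (hW : IsRegularPotential W B L) (ρ : P2 d) : 0 ≤ energy W ρ := by
  rw [hW.energy_eq]
  exact mul_nonneg (by norm_num) (integral_nonneg fun z => hW.nonneg _)

/-- The distance and the energy are minimised jointly over plans whose second marginal is free, with
the energy read off that marginal. The second marginal of an optimal plan is the minimiser: any
competitor `ν` is tested through an optimal plan from `μ` to `ν`. -/
theorem exists_isMinOn_jkoFunctional (hW : IsRegularPotential W B L) {τ : ℝ} (hτ : 0 < τ)
    (μ : P2 d) : ∃ ρ : P2 d, IsMinOn (jkoFunctional W τ μ) univ ρ := by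
  have hc : 0 < 1 / (2 * τ) := by positivity
  let G : ProbabilityMeasure (E d × E d) → ℝ := fun γ =>
    1 / 2 * ∫ z, W (z.1 - z.2) ∂(((γ.map measurable_snd.aemeasurable :
      ProbabilityMeasure (E d)) : Measure (E d)).prod
      ((γ.map measurable_snd.aemeasurable : ProbabilityMeasure (E d)) : Measure (E d)))
  have hG : Continuous G := by
    refine continuous_const.mul ((continuous_integral_prod_self_of_bounded
      (g := fun z : E d × E d => W (z.1 - z.2))
      (hW.continuous.comp (continuous_fst.sub continuous_snd)) fun _ => hW.norm_le _).comp ?_)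
    exact ProbabilityMeasure.continuous_map continuous_snd
  have hGe : ∀ {γ : ProbabilityMeasure (E d × E d)} {ν : P2 d}, γ ∈ transportPlans μ ν →
      G γ = energy W ν := by
    intro γ ν hγ
    have : ν.1 = γ.map measurable_snd.aemeasurable :=
      Subtype.ext ((ProbabilityMeasure.toMeasure_map γ measurable_snd.aemeasurable).trans hγ.2).symm
    rw [hW.energy_eq, P2.meas, this]
  obtain ⟨γ, hγ, hfin, hmin⟩ := exists_min_cost_add μ (isClosed_setOf_map_fst_eq μ.meas)
    (fun γ hγ => hγ) hG hc (prod_mem_transportPlans μ μ).1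
    (integrable_cost (prod_mem_transportPlans μ μ))
  have hint : Integrable (fun z : E d × E d => 1 / (2 * τ) * ‖z.1 - z.2‖ ^ 2)
      (γ : Measure (E d × E d)) := by
    refine ⟨by fun_prop, ?_⟩
    rw [hasFiniteIntegral_iff_ofReal (Eventually.of_forall fun z => by positivity)]
    exact hfin.lt_top
  obtain ⟨ρ, -, hρ⟩ := exists_mem_transportPlans μ γ hγ
    ((integrable_const_mul_iff hc.ne'.isUnit _).1 hint)
  refine ⟨ρ, fun ν _ => ?_⟩
  obtain ⟨γ', hγ', hopt⟩ := exists_optimal_plan μ ν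
  have h := hmin γ' hγ'.1
  have hnn : ∀ {γ : ProbabilityMeasure (E d × E d)},
      0 ≤ 1 / (2 * τ) * ∫ z, ‖z.1 - z.2‖ ^ 2 ∂(γ : Measure (E d × E d)) := fun {γ} =>
    mul_nonneg hc.le (integral_nonneg fun z : E d × E d => sq_nonneg ‖z.1 - z.2‖)
  rw [lintegral_cost_eq hρ hc.le, lintegral_cost_eq hγ' hc.le, hGe hρ, hGe hγ',
    ← ENNReal.ofReal_add hnn (hW.energy_nonneg _), ← ENNReal.ofReal_add hnn (hW.energy_nonneg _),
    ENNReal.ofReal_le_ofReal_iff (add_nonneg hnn (hW.energy_nonneg _)), hopt] at h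
  have h2 := mul_le_mul_of_nonneg_left (wassersteinSq_le hρ) hc.le
  simp only [mem_ofPred_eq, jkoFunctional, div_eq_mul_one_div (wassersteinSq _ _),
    mul_comm (wassersteinSq _ _)]
  linarith

theorem exists_isJKOSequence (hW : IsRegularPotential W B L) {τ : ℝ} (hτ : 0 < τ) (ρ₀ : P2 d) :
    ∃ r : ℕ → P2 d, IsJKOSequence W ρ₀ τ r := by
  choose f hf using hW.exists_isMinOn_jkoFunctional hτ
  exact ⟨fun n => f^[n] ρ₀, rfl, fun n => by
    simpa only [Function.iterate_succ_apply'] using hf _⟩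

end IsRegularPotential

end Energy

/-! ### Wasserstein estimates -/

section Wasserstein

variable {μ ν ξ : P2 d}

/-- Gluing: disintegrate `γ₂` over the common marginal `ν` and attach its conditional kernel to the
second coordinate of `γ₁`. -/
theorem exists_glued_plan {γ₁ γ₂ : ProbabilityMeasure (E d × E d)} (h₁ : γ₁ ∈ transportPlans μ ν)
    (h₂ : γ₂ ∈ transportPlans ν ξ) : ∃ π : ProbabilityMeasure ((E d × E d) × E d),
      (π : Measure ((E d × E d) × E d)).map Prod.fst = γ₁ ∧
      (π : Measure ((E d × E d) × E d)).map (fun z => (z.1.2, z.2)) = γ₂ := by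
  set κ := (γ₂ : Measure (E d × E d)).condKernel
  refine ⟨⟨(γ₁ : Measure (E d × E d)).compProd (κ.comap Prod.snd measurable_snd), inferInstance⟩,
    Measure.fst_compProd _ _, ?_⟩
  have h := (γ₂ : Measure (E d × E d)).disintegrate κ
  rw [ProbabilityMeasure.coe_mk]
  conv_rhs => rw [← h]
  refine Measure.ext_of_lintegral _ fun f hf => ?_
  rw [lintegral_map hf (by fun_prop), Measure.lintegral_compProd (by fun_prop),
    Measure.lintegral_compProd hf, Measure.fst, h₂.1, ← h₁.2,
    lintegral_map hf.lintegral_kernel_prod_right' measurable_snd]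
  rfl

/-- The triangle inequality in squared form, with Young's inequality of weight `a` on the cross term
of the glued plan. The free weight lets the iterated step bound be sharp. -/
theorem wassersteinSq_le_add (μ ν ξ : P2 d) {a : ℝ} (ha : 0 < a) :
    wassersteinSq μ ξ ≤ (1 + a⁻¹) * wassersteinSq μ ν + (1 + a) * wassersteinSq ν ξ := by
  obtain ⟨γ₁, h₁, e₁⟩ := exists_optimal_plan μ ν
  obtain ⟨γ₂, h₂, e₂⟩ := exists_optimal_plan ν ξ
  obtain ⟨π, hπ₁, hπ₂⟩ := exists_glued_plan h₁ h₂
  have m₁ : Measurable fun z : (E d × E d) × E d => z.1 := measurable_fst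
  have m₂ : Measurable fun z : (E d × E d) × E d => (z.1.2, z.2) := by fun_prop
  have m₃ : Measurable fun z : (E d × E d) × E d => (z.1.1, z.2) := by fun_prop
  have hγ : π.map m₃.aemeasurable ∈ transportPlans μ ξ := by
    constructor
    · rw [ProbabilityMeasure.toMeasure_map, Measure.map_map measurable_fst m₃, ← h₁.1, ← hπ₁,
        Measure.map_map measurable_fst m₁]
      rfl
    · rw [ProbabilityMeasure.toMeasure_map, Measure.map_map measurable_snd m₃, ← h₂.2, ← hπ₂,
        Measure.map_map measurable_snd m₂]
      rfl
  have i₁ : Integrable (fun z : (E d × E d) × E d => ‖z.1.1 - z.1.2‖ ^ 2)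
      (π : Measure ((E d × E d) × E d)) := by
    have h := integrable_cost h₁
    rw [← hπ₁] at h
    exact (integrable_map_measure (by fun_prop) m₁.aemeasurable).1 h
  have i₂ : Integrable (fun z : (E d × E d) × E d => ‖z.1.2 - z.2‖ ^ 2)
      (π : Measure ((E d × E d) × E d)) := by
    have h := integrable_cost h₂
    rw [← hπ₂] at h
    exact (integrable_map_measure (by fun_prop) m₂.aemeasurable).1 h
  refine (wassersteinSq_le hγ).trans ?_
  rw [← e₁, ← e₂, ← hπ₁, ← hπ₂, ProbabilityMeasure.toMeasure_map,
    integral_map m₃.aemeasurable (by fun_prop), integral_map m₁.aemeasurable (by fun_prop),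
    integral_map m₂.aemeasurable (by fun_prop), ← integral_const_mul, ← integral_const_mul,
    ← integral_add (i₁.const_mul _) (i₂.const_mul _)]
  refine integral_mono_of_nonneg (Eventually.of_forall fun z => by positivity)
    ((i₁.const_mul _).add (i₂.const_mul _)) (Eventually.of_forall fun z => ?_)
  have h : ‖z.1.1 - z.2‖ ≤ ‖z.1.1 - z.1.2‖ + ‖z.1.2 - z.2‖ :=
    norm_sub_le_norm_sub_add_norm_sub _ _ _
  have h' : 2 * (‖z.1.1 - z.1.2‖ * ‖z.1.2 - z.2‖) ≤
      a⁻¹ * ‖z.1.1 - z.1.2‖ ^ 2 + a * ‖z.1.2 - z.2‖ ^ 2 := by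
    have hs : a⁻¹ * ‖z.1.1 - z.1.2‖ ^ 2 + a * ‖z.1.2 - z.2‖ ^ 2 -
        2 * (‖z.1.1 - z.1.2‖ * ‖z.1.2 - z.2‖) =
        a⁻¹ * (‖z.1.1 - z.1.2‖ - a * ‖z.1.2 - z.2‖) ^ 2 := by
      field_simp
      ring
    have : 0 ≤ a⁻¹ * (‖z.1.1 - z.1.2‖ - a * ‖z.1.2 - z.2‖) ^ 2 := by positivity
    linarith
  have := pow_le_pow_left₀ (norm_nonneg _) h 2
  dsimp only
  linarith [add_sq ‖z.1.1 - z.1.2‖ ‖z.1.2 - z.2‖]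

theorem wassersteinSq_self (μ : P2 d) : wassersteinSq μ μ = 0 := by
  have m : Measurable fun x : E d => (x, x) := by fun_prop
  have hγ : μ.1.map m.aemeasurable ∈ transportPlans μ μ := by
    constructor
    · rw [ProbabilityMeasure.toMeasure_map, Measure.map_map measurable_fst m]
      exact Measure.map_id
    · rw [ProbabilityMeasure.toMeasure_map, Measure.map_map measurable_snd m]
      exact Measure.map_id
  refine le_antisymm ((wassersteinSq_le hγ).trans ?_) (wassersteinSq_nonneg _ _)
  rw [ProbabilityMeasure.toMeasure_map, integral_map m.aemeasurable (by fun_prop)]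
  simp

/-- For `ε > c`, Markov's inequality on an optimal plan gives mass at most `c³ / ε² ≤ ε` to the
pairs at distance at least `ε`; all other pairs stay within the `ε`-thickening. This is where the
cube in the hypothesis comes from. -/
theorem levyProkhorovDist_le {c : ℝ} (hc : 0 ≤ c) (h : wassersteinSq μ ν ≤ c ^ 3) :
    levyProkhorovDist μ.meas ν.meas ≤ c := by
  obtain ⟨γ, hγ, hopt⟩ := exists_optimal_plan μ ν
  refine levyProkhorovDist_le_of_forall_le _ _ hc fun ε A hε hA => ?_
  have hε0 : 0 < ε := hc.trans_lt hε
  have hfar : (γ : Measure (E d × E d)) {z | ε ≤ ‖z.1 - z.2‖} ≤ ENNReal.ofReal ε := by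
    have h1 := mul_meas_ge_le_lintegral (μ := (γ : Measure (E d × E d)))
      (f := fun z => ENNReal.ofReal (1 * ‖z.1 - z.2‖ ^ 2)) (by fun_prop) (ENNReal.ofReal (ε ^ 2))
    rw [lintegral_cost_eq hγ zero_le_one, hopt] at h1
    have h2 : ENNReal.ofReal (ε ^ 2) * (γ : Measure (E d × E d)) {z | ε ≤ ‖z.1 - z.2‖} ≤
        ENNReal.ofReal (ε ^ 2) * ENNReal.ofReal ε := by
      refine (mul_le_mul_right (measure_mono fun z hz => ?_) _).trans (h1.trans ?_)
      · refine ENNReal.ofReal_le_ofReal ?_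
        rw [one_mul]
        exact pow_le_pow_left₀ hε0.le hz 2
      · rw [← ENNReal.ofReal_mul (by positivity)]
        refine ENNReal.ofReal_le_ofReal ?_
        have := pow_le_pow_left₀ hc hε.le 3
        linarith [pow_succ ε 2]
    exact (ENNReal.mul_le_mul_iff_right (by simpa using hε0.ne') ENNReal.ofReal_ne_top).1 h2
  rw [← hγ.1, ← hγ.2, Measure.map_apply measurable_fst hA,
    Measure.map_apply measurable_snd Metric.isOpen_thickening.measurableSet]
  refine (measure_mono fun z hz => ?_).trans ((measure_union_le _ _).trans
    (add_le_add_right hfar _))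
  by_cases hd : ε ≤ ‖z.1 - z.2‖
  · exact Or.inr hd
  · refine Or.inl (Metric.mem_thickening_iff.2 ⟨z.1, hz, ?_⟩)
    rw [dist_comm, dist_eq_norm]
    exact not_le.1 hd

theorem integral_norm_sub_sq_le {γ : ProbabilityMeasure (E d × E d)} (hγ : γ ∈ transportPlans μ ν) :
    Integrable (fun z : E d × E d => ‖z.1 - z.2‖) (γ : Measure (E d × E d)) ∧
    (∫ z, ‖z.1 - z.2‖ ∂(γ : Measure (E d × E d))) ^ 2 ≤
      ∫ z, ‖z.1 - z.2‖ ^ 2 ∂(γ : Measure (E d × E d)) := by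
  have hi2 := integrable_cost hγ
  have hi : Integrable (fun z : E d × E d => ‖z.1 - z.2‖) (γ : Measure (E d × E d)) := by
    refine (hi2.add (integrable_const 1)).mono' (by fun_prop) (Eventually.of_forall fun z => ?_)
    rw [Real.norm_of_nonneg (norm_nonneg _)]
    simp only [Pi.add_apply]
    nlinarith [sq_nonneg (‖z.1 - z.2‖ - 1), norm_nonneg (z.1 - z.2)]
  refine ⟨hi, ?_⟩
  set m := ∫ z, ‖z.1 - z.2‖ ∂(γ : Measure (E d × E d)) with hm
  -- Nonnegativity of the variance of `‖z.1 - z.2‖`, in place of Cauchy–Schwarz.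
  have h0 : 0 ≤ ∫ z, (‖z.1 - z.2‖ ^ 2 - 2 * m * ‖z.1 - z.2‖ + m ^ 2)
      ∂(γ : Measure (E d × E d)) :=
    integral_nonneg fun z => by
      have := sq_nonneg (‖z.1 - z.2‖ - m)
      simp only [Pi.zero_apply]
      linarith [sub_sq ‖z.1 - z.2‖ m]
  have hi3 : Integrable (fun z : E d × E d => ‖z.1 - z.2‖ ^ 2 - 2 * m * ‖z.1 - z.2‖)
      (γ : Measure (E d × E d)) := hi2.sub (hi.const_mul _)
  rw [integral_add hi3 (integrable_const _),
    integral_sub hi2 (hi.const_mul _), integral_const_mul, ← hm] at h0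
  simp only [integral_const, probReal_univ, one_smul] at h0
  nlinarith

theorem integral_norm_sq_le (μ ν : P2 d) :
    ∫ x, ‖x‖ ^ 2 ∂ν.meas ≤ 2 * (∫ x, ‖x‖ ^ 2 ∂μ.meas) + 2 * wassersteinSq μ ν := by
  obtain ⟨γ, hγ, hopt⟩ := exists_optimal_plan μ ν
  have hs : StronglyMeasurable fun x : E d => ‖x‖ ^ 2 :=
    (continuous_norm.pow 2).stronglyMeasurable
  rw [← hopt, ← integral_fst_of_mem hγ hs, ← integral_snd_of_mem hγ hs, ← integral_const_mul,
    ← integral_const_mul, ← integral_add ((integrable_fst_sq hγ).const_mul 2)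
      ((integrable_cost hγ).const_mul 2)]
  refine integral_mono (integrable_snd_sq hγ) (((integrable_fst_sq hγ).const_mul 2).add
      ((integrable_cost hγ).const_mul 2)) fun z => ?_
  have := norm_sub_sq_le_two_mul z.1 (z.1 - z.2)
  rwa [sub_sub_cancel] at this

end Wasserstein

/-! ### A priori bounds on JKO sequences -/

section Steps

variable {W : E d → ℝ} {B L : ℝ} {μ ν : P2 d} {ρ₀ : P2 d} {τ : ℝ} {r : ℕ → P2 d}

theorem integral_prod_self_fst {γ : ProbabilityMeasure (E d × E d)}
    (hγ : γ ∈ transportPlans μ ν) {g : E d × E d → ℝ} (hg : Continuous g) :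
    ∫ z, g z ∂(μ.meas.prod μ.meas) = ∫ p, g (p.1.1, p.2.1)
      ∂((γ : Measure (E d × E d)).prod (γ : Measure (E d × E d))) := by
  rw [← hγ.1, Measure.map_prod_map _ _ measurable_fst measurable_fst,
    integral_map (by fun_prop) hg.aestronglyMeasurable]
  rfl

theorem integral_prod_self_snd {γ : ProbabilityMeasure (E d × E d)}
    (hγ : γ ∈ transportPlans μ ν) {g : E d × E d → ℝ} (hg : Continuous g) :
    ∫ z, g z ∂(ν.meas.prod ν.meas) = ∫ p, g (p.1.2, p.2.2)
      ∂((γ : Measure (E d × E d)).prod (γ : Measure (E d × E d))) := by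
  rw [← hγ.2, Measure.map_prod_map _ _ measurable_snd measurable_snd,
    integral_map (by fun_prop) hg.aestronglyMeasurable]
  rfl

namespace IsRegularPotential

theorem grad_bound_nonneg (hW : IsRegularPotential W B L) : 0 ≤ L :=
  (norm_nonneg _).trans (hW.norm_fderiv_le 0)

theorem abs_sub_le (hW : IsRegularPotential W B L) (x y : E d) : |W x - W y| ≤ L * ‖x - y‖ :=
  Convex.norm_image_sub_le_of_norm_fderiv_le (𝕜 := ℝ)
    (fun z _ => hW.contDiff.differentiable one_ne_zero z) (fun z _ => hW.norm_fderiv_le z)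
    convex_univ (mem_univ y) (mem_univ x)

/-- Two independent copies of the plan couple `μ ⊗ μ` with `ν ⊗ ν`. Each of the two arguments of
`W(x - y)` contributes one displacement, which cancels the factor `1/2` of the energy. -/
theorem energy_sub_le (hW : IsRegularPotential W B L) {γ : ProbabilityMeasure (E d × E d)}
    (hγ : γ ∈ transportPlans μ ν) :
    energy W μ - energy W ν ≤ L * ∫ z, ‖z.1 - z.2‖ ∂(γ : Measure (E d × E d)) := by
  have hc : Continuous fun z : E d × E d => W (z.1 - z.2) :=
    hW.continuous.comp (continuous_fst.sub continuous_snd)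
  have hi := (integral_norm_sub_sq_le hγ).1
  have hb1 : Integrable (fun p : (E d × E d) × (E d × E d) => W (p.1.1 - p.2.1))
      ((γ : Measure (E d × E d)).prod (γ : Measure (E d × E d))) :=
    integrable_of_bounded (hW.continuous.comp (by fun_prop)) (fun _ => hW.norm_le _) _
  have hb2 : Integrable (fun p : (E d × E d) × (E d × E d) => W (p.1.2 - p.2.2))
      ((γ : Measure (E d × E d)).prod (γ : Measure (E d × E d))) :=
    integrable_of_bounded (hW.continuous.comp (by fun_prop)) (fun _ => hW.norm_le _) _
  have hi1 : Integrable (fun p : (E d × E d) × (E d × E d) => ‖p.1.1 - p.1.2‖)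
      ((γ : Measure (E d × E d)).prod (γ : Measure (E d × E d))) := hi.comp_fst _
  have hi2 : Integrable (fun p : (E d × E d) × (E d × E d) => ‖p.2.1 - p.2.2‖)
      ((γ : Measure (E d × E d)).prod (γ : Measure (E d × E d))) := hi.comp_snd _
  have e1 : ∫ p : (E d × E d) × (E d × E d), ‖p.1.1 - p.1.2‖
      ∂((γ : Measure (E d × E d)).prod (γ : Measure (E d × E d))) =
      ∫ z, ‖z.1 - z.2‖ ∂(γ : Measure (E d × E d)) := by
    rw [integral_prod _ hi1]
    simp
  have e2 : ∫ p : (E d × E d) × (E d × E d), ‖p.2.1 - p.2.2‖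
      ∂((γ : Measure (E d × E d)).prod (γ : Measure (E d × E d))) =
      ∫ z, ‖z.1 - z.2‖ ∂(γ : Measure (E d × E d)) := by
    rw [integral_prod _ hi2]
    simp
  rw [hW.energy_eq, hW.energy_eq, integral_prod_self_fst hγ hc, integral_prod_self_snd hγ hc,
    ← mul_sub, ← integral_sub hb1 hb2]
  have key : ∫ p : (E d × E d) × (E d × E d), (W (p.1.1 - p.2.1) - W (p.1.2 - p.2.2))
      ∂((γ : Measure (E d × E d)).prod (γ : Measure (E d × E d))) ≤
      ∫ p : (E d × E d) × (E d × E d), L * (‖p.1.1 - p.1.2‖ + ‖p.2.1 - p.2.2‖)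
      ∂((γ : Measure (E d × E d)).prod (γ : Measure (E d × E d))) := by
    refine integral_mono (hb1.sub hb2) ((hi1.add hi2).const_mul L) fun p => ?_
    refine (le_abs_self _).trans ((hW.abs_sub_le _ _).trans
      (mul_le_mul_of_nonneg_left ?_ hW.grad_bound_nonneg))
    have : p.1.1 - p.2.1 - (p.1.2 - p.2.2) = (p.1.1 - p.1.2) - (p.2.1 - p.2.2) := by abel
    rw [this]
    exact norm_sub_le _ _
  rw [integral_const_mul, integral_add hi1 hi2, e1, e2] at key
  linarith

/-- Staying at `μ` is a competitor of zero cost. With `w` the squared distance and `m` the mean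
displacement, this gives `w ≤ 2Lτ m`; since `m² ≤ w`, squaring yields `w² ≤ (2Lτ)² w`, and `w`
cancels when it is positive. -/
theorem wassersteinSq_le_of_isMinOn (hW : IsRegularPotential W B L) (hτ : 0 < τ)
    (h : IsMinOn (jkoFunctional W τ μ) univ ν) : wassersteinSq μ ν ≤ (2 * L * τ) ^ 2 := by
  obtain ⟨γ, hγ, hopt⟩ := exists_optimal_plan μ ν
  have h1 := hW.energy_sub_le hγ
  have h2 := (integral_norm_sub_sq_le hγ).2
  have h3 : jkoFunctional W τ μ ν ≤ jkoFunctional W τ μ μ := h (mem_univ μ)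
  rw [jkoFunctional, jkoFunctional, wassersteinSq_self, zero_div] at h3
  rw [hopt] at h2
  set m := ∫ z, ‖z.1 - z.2‖ ∂(γ : Measure (E d × E d))
  set w := wassersteinSq μ ν
  have hw : 0 ≤ w := wassersteinSq_nonneg μ ν
  have h4 : w ≤ 2 * L * τ * m := by
    have : w / (2 * τ) ≤ L * m := by linarith
    rw [div_le_iff₀ (by positivity)] at this
    linarith
  have h5 : w * w ≤ (2 * L * τ) ^ 2 * w := by
    have := mul_self_le_mul_self hw h4
    have := mul_le_mul_of_nonneg_left h2 (sq_nonneg (2 * L * τ))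
    nlinarith
  rcases hw.eq_or_lt with h6 | h6
  · rw [← h6]
    positivity
  · exact le_of_mul_le_mul_right h5 h6

theorem wassersteinSq_add_le (hW : IsRegularPotential W B L) (hτ : 0 < τ)
    (hr : IsJKOSequence W ρ₀ τ r) (n m : ℕ) :
    wassersteinSq (r n) (r (n + m)) ≤ (2 * L * τ * m) ^ 2 := by
  induction m with
  | zero => simp [wassersteinSq_self]
  | succ m ih =>
    have hstep := hW.wassersteinSq_le_of_isMinOn hτ (hr.2 (n + m))
    rcases Nat.eq_zero_or_pos m with rfl | hm
    · simpa using hstep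
    -- The weight `a = m` closes the induction exactly: `(1 + 1/m) m² + (1 + m) = (m + 1)²`. It must
    -- be positive, hence the separate case `m = 0`.
    have hm' : (0 : ℝ) < m := Nat.cast_pos.2 hm
    calc wassersteinSq (r n) (r (n + (m + 1)))
        ≤ (1 + (m : ℝ)⁻¹) * wassersteinSq (r n) (r (n + m)) +
          (1 + m) * wassersteinSq (r (n + m)) (r (n + m + 1)) := wassersteinSq_le_add _ _ _ hm'
      _ ≤ (1 + (m : ℝ)⁻¹) * (2 * L * τ * m) ^ 2 + (1 + m) * (2 * L * τ) ^ 2 := by gcongr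
      _ = (2 * L * τ * (m + 1 : ℕ)) ^ 2 := by
        push_cast
        field_simp
        ring

theorem wassersteinSq_interpolation_le (hW : IsRegularPotential W B L) (hτ : 0 < τ)
    (hr : IsJKOSequence W ρ₀ τ r) {s t : ℝ} (hs : 0 ≤ s) (hst : s ≤ t) :
    wassersteinSq (interpolation τ r s) (interpolation τ r t) ≤ (2 * L * (t - s + τ)) ^ 2 := by
  have hmono : ⌈s / τ⌉₊ ≤ ⌈t / τ⌉₊ := Nat.ceil_mono (by gcongr)
  obtain ⟨m, hm⟩ := Nat.exists_eq_add_of_le hmono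
  have h := hW.wassersteinSq_add_le hτ hr ⌈s / τ⌉₊ m
  rw [← hm] at h
  refine h.trans (pow_le_pow_left₀ (by have := hW.grad_bound_nonneg; positivity) ?_ 2)
  rw [mul_assoc (2 * L)]
  refine mul_le_mul_of_nonneg_left ?_ (by have := hW.grad_bound_nonneg; positivity)
  -- Rounding up makes at most `(t - s)/τ + 1` steps fall between the two times; the extra step is
  -- the source of the `+ τ`.
  have h1 : (⌈t / τ⌉₊ : ℝ) < t / τ + 1 := Nat.ceil_lt_add_one (div_nonneg (hs.trans hst) hτ.le)
  have h2 : s / τ ≤ ⌈s / τ⌉₊ := Nat.le_ceil _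
  rw [hm] at h1
  push_cast at h1
  have h3 : τ * m ≤ τ * (t / τ + 1 - s / τ) := mul_le_mul_of_nonneg_left (by linarith) hτ.le
  have h4 : τ * (t / τ + 1 - s / τ) = t - s + τ := by
    field_simp
    ring
  linarith

theorem integral_norm_sq_interpolation_le (hW : IsRegularPotential W B L) (hτ : 0 < τ)
    (hr : IsJKOSequence W ρ₀ τ r) {t : ℝ} (ht : 0 ≤ t) :
    ∫ x, ‖x‖ ^ 2 ∂(interpolation τ r t).meas ≤
      2 * (∫ x, ‖x‖ ^ 2 ∂ρ₀.meas) + 2 * (2 * L * (t + τ)) ^ 2 := by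
  have h := hW.wassersteinSq_interpolation_le hτ hr le_rfl ht
  have h0 : interpolation τ r 0 = ρ₀ := by simp [interpolation, hr.1]
  rw [h0, sub_zero] at h
  linarith [integral_norm_sq_le ρ₀ (interpolation τ r t)]

end IsRegularPotential

end Steps

/-- The probability measures whose second moment is at most `M`. -/
def momentBall (d : ℕ) (M : ℝ) : Set (ProbabilityMeasure (E d)) :=
  {μ | ∫⁻ x, ENNReal.ofReal (‖x‖ ^ 2) ∂(μ : Measure (E d)) ≤ ENNReal.ofReal M}

theorem isCompact_momentBall (M : ℝ) : IsCompact (momentBall d M) :=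
  isCompact_setOf_lintegral_norm_sq_le ENNReal.ofReal_ne_top

theorem integrable_of_mem_momentBall {M : ℝ} {μ : ProbabilityMeasure (E d)}
    (hμ : μ ∈ momentBall d M) : Integrable (fun x => ‖x‖ ^ 2) (μ : Measure (E d)) := by
  refine ⟨by fun_prop, ?_⟩
  rw [hasFiniteIntegral_iff_ofReal (Eventually.of_forall fun z => by positivity)]
  exact lt_of_le_of_lt hμ ENNReal.ofReal_lt_top

theorem mem_momentBall {M : ℝ} (μ : P2 d) (h : ∫ x, ‖x‖ ^ 2 ∂μ.meas ≤ M) :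
    μ.1 ∈ momentBall d M := by
  have h1 := ofReal_integral_eq_lintegral_ofReal μ.2 (Eventually.of_forall fun z => by positivity)
  exact h1.symm.trans_le (ENNReal.ofReal_le_ofReal h)

/-- Lower semicontinuity of the squared Wasserstein distance under narrow convergence. -/
theorem wassersteinSq_le_of_tendsto {ι : Type*} (U : Ultrafilter ι) {μ ν : ι → P2 d}
    {μ' ν' : P2 d} {M : ℝ} (hμ : Tendsto (fun i => (μ i).1) U (𝓝 μ'.1))
    (hν : Tendsto (fun i => (ν i).1) U (𝓝 ν'.1)) (hM : 0 ≤ M)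
    (hμM : ∀ᶠ i in U, (μ i).1 ∈ momentBall d M) (hνM : ∀ᶠ i in U, (ν i).1 ∈ momentBall d M)
    {c : ι → ℝ} {c' : ℝ} (hw : ∀ᶠ i in U, wassersteinSq (μ i) (ν i) ≤ c i)
    (hc : Tendsto c U (𝓝 c')) : wassersteinSq μ' ν' ≤ c' := by
  -- The second moments of both marginals bound those of the optimal plans, so these converge along
  -- the ultrafilter. The limit is a plan between the limit measures, and its cost is bounded by
  -- lower semicontinuity.
  choose γ hγ hopt using fun i => exists_optimal_plan (μ i) (ν i)
  have hcomp : IsCompact {γ : ProbabilityMeasure (E d × E d) |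
      ∫⁻ z, ENNReal.ofReal (‖z‖ ^ 2) ∂(γ : Measure (E d × E d)) ≤ ENNReal.ofReal (M + M)} :=
    isCompact_setOf_lintegral_norm_sq_le ENNReal.ofReal_ne_top
  have hmem : ∀ᶠ i in U, γ i ∈ {γ : ProbabilityMeasure (E d × E d) |
      ∫⁻ z, ENNReal.ofReal (‖z‖ ^ 2) ∂(γ : Measure (E d × E d)) ≤ ENNReal.ofReal (M + M)} := by
    filter_upwards [hμM, hνM] with i h1 h2
    have h3 : ∫⁻ z : E d × E d, ENNReal.ofReal (‖z‖ ^ 2) ∂(γ i : Measure (E d × E d)) ≤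
        ∫⁻ z : E d × E d, (ENNReal.ofReal (‖z.1‖ ^ 2) + ENNReal.ofReal (‖z.2‖ ^ 2))
          ∂(γ i : Measure (E d × E d)) := by
      refine lintegral_mono fun z => ?_
      rw [← ENNReal.ofReal_add (by positivity) (by positivity)]
      refine ENNReal.ofReal_le_ofReal ?_
      rcases max_cases ‖z.1‖ ‖z.2‖ with ⟨h, -⟩ | ⟨h, -⟩ <;> rw [Prod.norm_def, h] <;>
        nlinarith [sq_nonneg ‖z.1‖, sq_nonneg ‖z.2‖]
    refine h3.trans ?_
    rw [lintegral_add_left (by fun_prop), ENNReal.ofReal_add hM hM]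
    refine add_le_add (le_trans (le_of_eq ?_) h1) (le_trans (le_of_eq ?_) h2)
    · change _ = ∫⁻ x, ENNReal.ofReal (‖x‖ ^ 2) ∂(μ i).meas
      rw [← (hγ i).1, lintegral_map (by fun_prop) measurable_fst]
    · change _ = ∫⁻ x, ENNReal.ofReal (‖x‖ ^ 2) ∂(ν i).meas
      rw [← (hγ i).2, lintegral_map (by fun_prop) measurable_snd]
  obtain ⟨γ', -, hγ'⟩ := hcomp.ultrafilter_le_nhds (U.map γ)
    (by rw [Ultrafilter.coe_map]; exact le_principal_iff.2 (mem_map.2 hmem))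
  have hlim : Tendsto γ U (𝓝 γ') := hγ'
  have hplan : γ' ∈ transportPlans μ' ν' := by
    constructor
    · have h1 := ((ProbabilityMeasure.continuous_map
        (continuous_fst (X := E d) (Y := E d))).tendsto γ').comp hlim
      have h2 : (fun i => (μ i).1) = (fun ν => ProbabilityMeasure.map ν
          (continuous_fst (X := E d) (Y := E d)).measurable.aemeasurable) ∘ γ := funext fun i =>
        Subtype.ext ((ProbabilityMeasure.toMeasure_map (γ i) measurable_fst.aemeasurable).trans
          (hγ i).1).symm
      rw [h2] at hμ
      have h3 := tendsto_nhds_unique h1 hμ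
      rw [P2.meas, ← h3, ProbabilityMeasure.toMeasure_map]
    · have h1 := ((ProbabilityMeasure.continuous_map
        (continuous_snd (X := E d) (Y := E d))).tendsto γ').comp hlim
      have h2 : (fun i => (ν i).1) = (fun ν => ProbabilityMeasure.map ν
          (continuous_snd (X := E d) (Y := E d)).measurable.aemeasurable) ∘ γ := funext fun i =>
        Subtype.ext ((ProbabilityMeasure.toMeasure_map (γ i) measurable_snd.aemeasurable).trans
          (hγ i).2).symm
      rw [h2] at hν
      have h3 := tendsto_nhds_unique h1 hν
      rw [P2.meas, ← h3, ProbabilityMeasure.toMeasure_map]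
  have hc0 : 0 ≤ c' := ge_of_tendsto hc (hw.mono fun i hi => (wassersteinSq_nonneg _ _).trans hi)
  refine le_of_forall_pos_le_add fun η hη => (wassersteinSq_le hplan).trans ?_
  have hcl := isClosed_setOf_lintegral_ofReal_le (X := E d × E d)
    (f := fun z => 1 * ‖z.1 - z.2‖ ^ 2) (by fun_prop) (ENNReal.ofReal (c' + η))
  have h1 := hcl.mem_of_tendsto hlim (by
    filter_upwards [hw, hc.eventually (gt_mem_nhds (lt_add_of_pos_right c' hη))] with i h1 h2
    rw [lintegral_cost_eq (hγ i) zero_le_one, one_mul, hopt]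
    exact ENNReal.ofReal_le_ofReal (h1.trans h2.le))
  rw [mem_ofPred_eq, lintegral_cost_eq hplan zero_le_one, one_mul,
    ENNReal.ofReal_le_ofReal_iff (by positivity)] at h1
  exact h1

/-- The modulus of continuity of JKO interpolations in the Lévy-Prokhorov distance. -/
def lpModulus (L x : ℝ) : ℝ := ((2 * L * x) ^ 2) ^ (((3 : ℕ) : ℝ)⁻¹)

theorem continuous_lpModulus (L : ℝ) : Continuous (lpModulus L) :=
  Continuous.rpow_const (by fun_prop) fun _ => Or.inr (by positivity)

@[simp] theorem lpModulus_zero (L : ℝ) : lpModulus L 0 = 0 := by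
  simp [lpModulus]

theorem lpModulus_nonneg (L x : ℝ) : 0 ≤ lpModulus L x := Real.rpow_nonneg (sq_nonneg _) _

theorem lpModulus_pow (L x : ℝ) : lpModulus L x ^ 3 = (2 * L * x) ^ 2 :=
  Real.rpow_inv_natCast_pow (sq_nonneg _) (by norm_num)

theorem lpModulus_mono {L x y : ℝ} (hL : 0 ≤ L) (hx : 0 ≤ x) (hxy : x ≤ y) :
    lpModulus L x ≤ lpModulus L y :=
  Real.rpow_le_rpow (sq_nonneg _) (by gcongr) (by positivity)

/-! ### Compactness of the interpolations and the limit curve -/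

section Curves

variable {W : E d → ℝ} {B L T : ℝ} {ρ₀ : P2 d} {R : ℝ → ℕ → P2 d}

theorem IsRegularPotential.levyProkhorovDist_interpolation_le (hW : IsRegularPotential W B L)
    {τ : ℝ} (hτ : 0 < τ) {r : ℕ → P2 d} (hr : IsJKOSequence W ρ₀ τ r) {s t : ℝ} (hs : 0 ≤ s)
    (ht : 0 ≤ t) :
    levyProkhorovDist (interpolation τ r s).meas (interpolation τ r t).meas ≤
      lpModulus L (|t - s| + τ) := by
  rcases le_total s t with hst | hst
  · refine levyProkhorovDist_le (lpModulus_nonneg _ _) ?_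
    rw [lpModulus_pow, abs_of_nonneg (sub_nonneg.2 hst)]
    exact hW.wassersteinSq_interpolation_le hτ hr hs hst
  · rw [levyProkhorovDist_comm]
    refine levyProkhorovDist_le (lpModulus_nonneg _ _) ?_
    rw [lpModulus_pow, abs_sub_comm, abs_of_nonneg (sub_nonneg.2 hst)]
    exact hW.wassersteinSq_interpolation_le hτ hr ht hst

theorem tendsto_ofMeasure {ι : Type*} {l : Filter ι} {μ : ι → ProbabilityMeasure (E d)}
    {μ' : ProbabilityMeasure (E d)} (h : Tendsto μ l (𝓝 μ')) :
    Tendsto (fun i => LevyProkhorov.ofMeasure (μ i)) l (𝓝 (LevyProkhorov.ofMeasure μ')) :=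
  (LevyProkhorov.continuous_ofMeasure_probabilityMeasure.tendsto μ').comp h

theorem IsRegularPotential.dist_limit_le (hW : IsRegularPotential W B L)
    (hR : ∀ τ, 0 < τ → IsJKOSequence W ρ₀ τ (R τ)) {ι : Type*} {l : Filter ι} [l.NeBot]
    {τ : ι → ℝ} (hτ : ∀ᶠ i in l, 0 < τ i) (hτ0 : Tendsto τ l (𝓝 0)) {ρ : ℝ → P2 d}
    {s t : ℝ} (hs : 0 ≤ s) (ht : 0 ≤ t)
    (hρs : Tendsto (fun i => (interpolation (τ i) (R (τ i)) s).1) l (𝓝 (ρ s).1))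
    (hρt : Tendsto (fun i => (interpolation (τ i) (R (τ i)) t).1) l (𝓝 (ρ t).1)) :
    dist (LevyProkhorov.ofMeasure (ρ s).1) (LevyProkhorov.ofMeasure (ρ t).1) ≤
      lpModulus L |t - s| := by
  have h1 := (tendsto_ofMeasure hρs).dist (tendsto_ofMeasure hρt)
  have h2 : Tendsto (fun i => lpModulus L (|t - s| + τ i)) l (𝓝 (lpModulus L |t - s|)) := by
    have := ((continuous_lpModulus L).tendsto (|t - s| + 0)).comp (hτ0.const_add |t - s|)
    simpa [Function.comp_def] using this
  refine le_of_tendsto_of_tendsto h1 h2 ?_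
  filter_upwards [hτ] with i hi
  exact hW.levyProkhorovDist_interpolation_le hi (hR _ hi) hs ht

theorem continuousOn_of_dist_le {ρ : ℝ → P2 d} (h : ∀ s ∈ Icc 0 T, ∀ t ∈ Icc 0 T,
    dist (LevyProkhorov.ofMeasure (ρ s).1) (LevyProkhorov.ofMeasure (ρ t).1) ≤
      lpModulus L |t - s|) :
    ContinuousOn (fun t => LevyProkhorov.ofMeasure (ρ t).1) (Icc 0 T) := by
  intro s hs
  rw [ContinuousWithinAt, tendsto_iff_dist_tendsto_zero]
  have h2 : Tendsto (fun t => lpModulus L |s - t|) (𝓝[Icc 0 T] s) (𝓝 0) := by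
    have : Continuous fun t => lpModulus L |s - t| := (continuous_lpModulus L).comp (by fun_prop)
    simpa using (this.tendsto s).mono_left nhdsWithin_le_nhds
  refine squeeze_zero' (Eventually.of_forall fun _ => dist_nonneg) ?_ h2
  filter_upwards [self_mem_nhdsWithin] with t ht
  exact h t ht s hs

theorem NarrowUniformLimit.tendsto {ρk : ℕ → ℝ → P2 d} {ρ : ℝ → P2 d}
    (h : NarrowUniformLimit T ρk ρ) {t : ℝ} (ht : t ∈ Icc 0 T) :
    Tendsto (fun k => (ρk k t).1) atTop (𝓝 (ρ t).1) :=
  ProbabilityMeasure.tendsto_iff_forall_integral_tendsto.2 fun f => (h f).tendsto_at ht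

theorem IsRegularPotential.continuousOn_limit (hW : IsRegularPotential W B L)
    (hR : ∀ τ, 0 < τ → IsJKOSequence W ρ₀ τ (R τ)) {ρ : ℝ → P2 d} (hρ : IsJKOLimitCurve T R ρ) :
    ContinuousOn (fun t => (ρ t).1) (Icc 0 T) := by
  obtain ⟨τ, hτ, hτ0, hlim⟩ := hρ
  have h := continuousOn_of_dist_le (ρ := ρ) (L := L) fun s hs t ht =>
    hW.dist_limit_le hR (Eventually.of_forall hτ) hτ0 hs.1 ht.1 (hlim.tendsto hs) (hlim.tendsto ht)
  exact LevyProkhorov.continuous_toMeasure_probabilityMeasure.comp_continuousOn h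

/-- Integration against `f` is continuous in the Lévy–Prokhorov metric, and the image of `[0,T]`
under `ρ` is compact, so one `δ` serves all its points. Only the limit curve has to lie in that
compact set. -/
theorem narrowUniformLimit_of_dist_le {ρk : ℕ → ℝ → P2 d} {ρ : ℝ → P2 d}
    (hρ : ContinuousOn (fun t => LevyProkhorov.ofMeasure (ρ t).1) (Icc 0 T))
    {u : ℕ → ℝ} (hu : Tendsto u atTop (𝓝 0)) (h : ∀ k, ∀ t ∈ Icc 0 T,
      dist (LevyProkhorov.ofMeasure (ρ t).1) (LevyProkhorov.ofMeasure (ρk k t).1) ≤ u k) :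
    NarrowUniformLimit T ρk ρ := by
  intro f
  rw [Metric.tendstoUniformlyOn_iff]
  intro η hη
  have hg : Continuous fun μ : LevyProkhorov (ProbabilityMeasure (E d)) =>
      ∫ x, f x ∂(μ.toMeasure : Measure (E d)) :=
    (ProbabilityMeasure.continuous_integral_boundedContinuousFunction f).comp
      LevyProkhorov.continuous_toMeasure_probabilityMeasure
  have hu' := (isCompact_Icc.image_of_continuousOn hρ).uniformContinuousAt_of_continuousAt _
    (fun a _ => hg.continuousAt) (Metric.dist_mem_uniformity hη)
  obtain ⟨δ, hδ, hsub⟩ := Metric.mem_uniformity_dist.1 hu'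
  filter_upwards [hu.eventually (gt_mem_nhds hδ)] with k hk t ht
  exact hsub ((h k t ht).trans_lt hk) ⟨t, ht, rfl⟩

/-- An ultrafilter limit as `τ → 0+` supplies convergence at all times at once, replacing a diagonal
extraction over a dense set of times. The common modulus of continuity makes the convergence
uniform, and only then is an actual sequence of time steps selected. -/
theorem IsRegularPotential.exists_limit_curve (hW : IsRegularPotential W B L)
    (hR : ∀ τ, 0 < τ → IsJKOSequence W ρ₀ τ (R τ)) :
    ∃ ρ : ℝ → P2 d, IsACCurve T ρ ∧ IsJKOLimitCurve T R ρ := by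
  have hL := hW.grad_bound_nonneg
  let U : Ultrafilter ℝ := Ultrafilter.of (𝓝[>] (0 : ℝ))
  have hU : (U : Filter ℝ) ≤ 𝓝[>] 0 := Ultrafilter.of_le _
  have hpos : ∀ᶠ τ in (U : Filter ℝ), 0 < τ := hU self_mem_nhdsWithin
  have hzero : Tendsto (fun τ : ℝ => τ) U (𝓝 0) := hU.trans nhdsWithin_le_nhds
  set M : ℝ := 2 * (∫ x, ‖x‖ ^ 2 ∂ρ₀.meas) + 2 * (2 * L * (T + 1)) ^ 2 with hMdef
  have hM : 0 ≤ M := by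
    have : 0 ≤ ∫ x, ‖x‖ ^ 2 ∂ρ₀.meas := integral_nonneg fun x => by positivity
    positivity
  have hmem : ∀ t ∈ Icc 0 T, ∀ᶠ τ in (U : Filter ℝ),
      (interpolation τ (R τ) t).1 ∈ momentBall d M := by
    intro t ht
    filter_upwards [hpos, hzero.eventually (gt_mem_nhds one_pos)] with τ h1 h2
    refine mem_momentBall _
      ((hW.integral_norm_sq_interpolation_le h1 (hR τ h1) ht.1).trans ?_)
    have ht0 := ht.1
    have htT := ht.2
    rw [hMdef]
    gcongr
  have hex : ∀ t, ∃ ρ : P2 d, t ∈ Icc 0 T →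
      Tendsto (fun τ => (interpolation τ (R τ) t).1) U (𝓝 ρ.1) := by
    intro t
    by_cases ht : t ∈ Icc 0 T
    · obtain ⟨μ, hμ, hle⟩ := (isCompact_momentBall (d := d) M).ultrafilter_le_nhds
        (U.map fun τ => (interpolation τ (R τ) t).1)
        (by rw [Ultrafilter.coe_map]; exact le_principal_iff.2 (mem_map.2 (hmem t ht)))
      exact ⟨⟨μ, integrable_of_mem_momentBall hμ⟩, fun _ => hle⟩
    · exact ⟨ρ₀, fun h => absurd h ht⟩
  choose ρ hρ using hex
  refine ⟨ρ, ⟨fun _ => 2 * L, integrableOn_const (by simp), fun s t hs hst ht => ?_⟩, ?_⟩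
  · have hs' : s ∈ Icc 0 T := ⟨hs, hst.trans ht⟩
    have ht' : t ∈ Icc 0 T := ⟨hs.trans hst, ht⟩
    have hw : wassersteinSq (ρ s) (ρ t) ≤ (2 * L * (t - s)) ^ 2 := by
      refine wassersteinSq_le_of_tendsto U (hρ s hs') (hρ t ht') hM (hmem s hs') (hmem t ht')
        (c := fun τ => (2 * L * (t - s + τ)) ^ 2) ?_ ?_
      · filter_upwards [hpos] with τ hτ
        exact hW.wassersteinSq_interpolation_le hτ (hR τ hτ) hs hst
      · have hc : Continuous fun τ : ℝ => (2 * L * (t - s + τ)) ^ 2 := by fun_prop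
        simpa [Function.comp_def] using (hc.tendsto 0).comp hzero
    rw [intervalIntegral.integral_const, smul_eq_mul, wassersteinDist]
    refine Real.sqrt_le_iff.2 ⟨mul_nonneg (sub_nonneg.2 hst) (by positivity), ?_⟩
    rwa [mul_comm]
  · have hdist : ∀ s ∈ Icc 0 T, ∀ t ∈ Icc 0 T,
        dist (LevyProkhorov.ofMeasure (ρ s).1) (LevyProkhorov.ofMeasure (ρ t).1) ≤
          lpModulus L |t - s| := fun s hs t ht =>
      hW.dist_limit_le hR hpos hzero hs.1 ht.1 (hρ s hs) (hρ t ht)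
    -- Three errors of size `η/3`: the modulus of the limit curve, convergence at the nearest point
    -- of a finite `δ`-net, and the modulus of the interpolation. The last involves `|t - s| + τ < δ
    -- + δ`, which is why `δ` is chosen through `lpModulus L (x + x)`.
    have hunif : ∀ η : ℝ, 0 < η → ∀ᶠ τ in (U : Filter ℝ), ∀ t ∈ Icc 0 T,
        dist (LevyProkhorov.ofMeasure (ρ t).1)
          (LevyProkhorov.ofMeasure (interpolation τ (R τ) t).1) ≤ η := by
      intro η hη
      have hω : ∀ᶠ x in 𝓝[>] (0 : ℝ), lpModulus L (x + x) < η / 3 := by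
        have hc : Continuous fun x => lpModulus L (x + x) :=
          (continuous_lpModulus L).comp (by fun_prop)
        have := (hc.tendsto 0).mono_left (nhdsWithin_le_nhds (s := Ioi 0))
        simp only [add_zero, lpModulus_zero] at this
        exact this.eventually (gt_mem_nhds (by positivity))
      obtain ⟨δ, hδη, hδ⟩ := (hω.and self_mem_nhdsWithin).exists
      have hδ0 : 0 < δ := hδ
      obtain ⟨S, hST, hSfin, hcover⟩ := (isCompact_Icc (a := (0 : ℝ)) (b := T)).finite_cover_balls hδ0
      have hgrid : ∀ᶠ τ in (U : Filter ℝ), ∀ s ∈ S,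
          dist (LevyProkhorov.ofMeasure (ρ s).1)
            (LevyProkhorov.ofMeasure (interpolation τ (R τ) s).1) < η / 3 := by
        refine (eventually_all_finite hSfin).2 fun s hs => ?_
        have h1 := tendsto_iff_dist_tendsto_zero.1 (tendsto_ofMeasure (hρ s (hST hs)))
        filter_upwards [h1.eventually (gt_mem_nhds (by positivity : 0 < η / 3))] with τ hτ
        rwa [dist_comm]
      filter_upwards [hgrid, hpos, hzero.eventually (gt_mem_nhds hδ0)] with τ h1 h2 h3 t ht
      obtain ⟨s, hs, hts⟩ := mem_iUnion₂.1 (hcover ht)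
      have hts' : |t - s| < δ := hts
      have d1 := hdist t ht s (hST hs)
      have d2 := hW.levyProkhorovDist_interpolation_le h2 (hR τ h2) (hST hs).1 ht.1
      have m1 : lpModulus L |s - t| ≤ lpModulus L (δ + δ) :=
        lpModulus_mono hL (abs_nonneg _) (by rw [abs_sub_comm]; linarith)
      have m2 : lpModulus L (|t - s| + τ) ≤ lpModulus L (δ + δ) :=
        lpModulus_mono hL (by positivity) (by linarith)
      have d3 := h1 s hs
      have tri := dist_triangle4 (LevyProkhorov.ofMeasure (ρ t).1)
        (LevyProkhorov.ofMeasure (ρ s).1)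
        (LevyProkhorov.ofMeasure (interpolation τ (R τ) s).1)
        (LevyProkhorov.ofMeasure (interpolation τ (R τ) t).1)
      have d2' : dist (LevyProkhorov.ofMeasure (interpolation τ (R τ) s).1)
        (LevyProkhorov.ofMeasure (interpolation τ (R τ) t).1) ≤ lpModulus L (|t - s| + τ) := d2
      linarith
    -- Each requirement holds eventually along the ultrafilter, so for every `k` some `τ` satisfies
    -- them all.
    have hchoose : ∀ k : ℕ, ∃ τ : ℝ, 0 < τ ∧ τ < 1 / ((k : ℝ) + 1) ∧ ∀ t ∈ Icc 0 T,
        dist (LevyProkhorov.ofMeasure (ρ t).1)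
          (LevyProkhorov.ofMeasure (interpolation τ (R τ) t).1) ≤ 1 / ((k : ℝ) + 1) := fun k =>
      (hpos.and ((hzero.eventually (gt_mem_nhds Nat.one_div_pos_of_nat)).and
        (hunif _ Nat.one_div_pos_of_nat))).exists
    choose τ hτ0 hτ1 hτ using hchoose
    exact ⟨τ, hτ0, squeeze_zero (fun k => (hτ0 k).le) (fun k => (hτ1 k).le)
      tendsto_one_div_add_atTop_nhds_zero_nat, narrowUniformLimit_of_dist_le
      (continuousOn_of_dist_le hdist) tendsto_one_div_add_atTop_nhds_zero_nat hτ⟩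

end Curves

theorem inner_gradient (f : E d → ℝ) (x v : E d) : inner ℝ (gradient f x) v = fderiv ℝ f x v := by
  simp [gradient, InnerProductSpace.toDual_symm_apply]

theorem continuous_gradient {f : E d → ℝ} (hf : ContDiff ℝ 1 f) : Continuous (gradient f) :=
  (InnerProductSpace.toDual ℝ (E d)).symm.continuous.comp (hf.continuous_fderiv one_ne_zero)

/-! ### Euler–Lagrange identity and one-step error -/

section EulerLagrange

variable {W φ : E d → ℝ} {B L : ℝ} {μ ν : P2 d} {τ : ℝ}

/-- First variation of the transport cost when the second marginal is displaced along `ξ`. -/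
theorem hasDerivAt_cost {γ : ProbabilityMeasure (E d × E d)} (hγ : γ ∈ transportPlans μ ν)
    {ξ : E d → E d} (hξ : Continuous ξ) {C : ℝ} (hC : ∀ x, ‖ξ x‖ ≤ C) :
    HasDerivAt (fun s : ℝ => ∫ z, ‖z.1 - (z.2 + s • ξ z.2)‖ ^ 2 ∂(γ : Measure (E d × E d)))
      (2 * ∫ z, inner ℝ (z.2 - z.1) (ξ z.2) ∂(γ : Measure (E d × E d))) 0 := by
  have hi := integrable_cost hγ
  have hi1 := (integral_norm_sub_sq_le hγ).1
  have hi2 : Integrable (fun z : E d × E d => inner ℝ (z.2 - z.1) (ξ z.2))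
      (γ : Measure (E d × E d)) := by
    refine (hi1.const_mul C).mono' (by fun_prop) (Eventually.of_forall fun z => ?_)
    refine (norm_inner_le_norm _ _).trans ?_
    rw [norm_sub_rev, mul_comm]
    exact mul_le_mul_of_nonneg_right (hC _) (norm_nonneg _)
  have hi3 : Integrable (fun z : E d × E d => ‖ξ z.2‖ ^ 2) (γ : Measure (E d × E d)) :=
    integrable_of_bounded (C := C ^ 2) (by fun_prop) (fun z => by
      rw [Real.norm_of_nonneg (by positivity)]
      exact pow_le_pow_left₀ (norm_nonneg _) (hC _) 2) _
  set a := ∫ z, ‖z.1 - z.2‖ ^ 2 ∂(γ : Measure (E d × E d))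
  set b := ∫ z, inner ℝ (z.2 - z.1) (ξ z.2) ∂(γ : Measure (E d × E d))
  set c := ∫ z, ‖ξ z.2‖ ^ 2 ∂(γ : Measure (E d × E d))
  -- The displaced cost is exactly a quadratic polynomial in `s`, so no limit under the integral is
  -- needed.
  have heq : ∀ s : ℝ, ∫ z, ‖z.1 - (z.2 + s • ξ z.2)‖ ^ 2 ∂(γ : Measure (E d × E d)) =
      a + s * 2 * b + s ^ 2 * c := by
    intro s
    have hab : Integrable (fun z : E d × E d =>
        ‖z.1 - z.2‖ ^ 2 + s * 2 * inner ℝ (z.2 - z.1) (ξ z.2)) (γ : Measure (E d × E d)) :=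
      hi.add (hi2.const_mul _)
    rw [← integral_const_mul, ← integral_const_mul, ← integral_add hi (hi2.const_mul _),
      ← integral_add hab (hi3.const_mul _)]
    refine integral_congr_ae (Eventually.of_forall fun z => ?_)
    have h1 : z.1 - (z.2 + s • ξ z.2) = (z.1 - z.2) - s • ξ z.2 := by abel
    have h2 : inner ℝ (z.1 - z.2) (ξ z.2) = -inner ℝ (z.2 - z.1) (ξ z.2) := by
      rw [← inner_neg_left, neg_sub]
    dsimp only
    rw [h1, norm_sub_sq_real, inner_smul_right, h2, norm_smul, mul_pow, Real.norm_eq_abs, sq_abs]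
    ring
  simp_rw [heq]
  have h := (((hasDerivAt_id' (0 : ℝ)).mul_const 2).mul_const b |>.const_add a).add
    ((hasDerivAt_pow 2 (0 : ℝ)).mul_const c)
  simpa using! h

/-- First variation of the interaction energy along a displacement `ξ`. -/
theorem IsRegularPotential.hasDerivAt_energy (hW : IsRegularPotential W B L)
    (μ : Measure (E d × E d)) [IsFiniteMeasure μ]
    {ξ : E d → E d} (hξ : Continuous ξ) {C : ℝ} (hC : ∀ x, ‖ξ x‖ ≤ C) :
    HasDerivAt (fun s : ℝ => ∫ z, W (z.1 + s • ξ z.1 - (z.2 + s • ξ z.2)) ∂μ)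
      (∫ z, fderiv ℝ W (z.1 - z.2) (ξ z.1 - ξ z.2) ∂μ) 0 := by
  have hcf := hW.contDiff.continuous_fderiv one_ne_zero
  have hcW := hW.continuous
  have h := (hasDerivAt_integral_of_dominated_loc_of_deriv_le (μ := μ)
    (F := fun (s : ℝ) (z : E d × E d) => W (z.1 + s • ξ z.1 - (z.2 + s • ξ z.2)))
    (F' := fun (s : ℝ) (z : E d × E d) =>
      fderiv ℝ W (z.1 + s • ξ z.1 - (z.2 + s • ξ z.2)) (ξ z.1 - ξ z.2))
    (x₀ := 0) (s := univ) (bound := fun _ => L * (C + C)) univ_mem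
    (Eventually.of_forall fun s => by fun_prop)
    (integrable_of_bounded (by fun_prop) (fun _ => hW.norm_le _) _)
    (Continuous.aestronglyMeasurable (by fun_prop)) (Eventually.of_forall fun z s _ => ?_)
    (integrable_const _) (Eventually.of_forall fun z s _ => ?_)).2
  · simpa using h
  · refine (ContinuousLinearMap.le_opNorm _ _).trans (mul_le_mul (hW.norm_fderiv_le _)
      ((norm_sub_le _ _).trans (add_le_add (hC _) (hC _))) (norm_nonneg _) hW.grad_bound_nonneg)
  · have h1 : HasDerivAt (fun s : ℝ => z.1 + s • ξ z.1 - (z.2 + s • ξ z.2)) (ξ z.1 - ξ z.2) s := by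
      have := (((hasDerivAt_id s).smul_const (ξ z.1)).const_add z.1).sub
        (((hasDerivAt_id s).smul_const (ξ z.2)).const_add z.2)
      simpa using! this
    exact (hW.contDiff.differentiable one_ne_zero _).hasFDerivAt.comp_hasDerivAt s h1

/-- `F s` uses the displaced plan, which need not be optimal for the displaced measure; it still
bounds the JKO functional there from above, with equality at `s = 0`. Hence `F` is minimal at `0`
and its derivative vanishes. Only continuity and boundedness of `ξ` are needed, as `ξ` itself is
never differentiated. -/
theorem IsRegularPotential.euler_lagrange (hW : IsRegularPotential W B L)
    (hmin : IsMinOn (jkoFunctional W τ μ) univ ν)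
    {γ : ProbabilityMeasure (E d × E d)} (hγ : γ ∈ transportPlans μ ν)
    (hopt : ∫ z, ‖z.1 - z.2‖ ^ 2 ∂(γ : Measure (E d × E d)) = wassersteinSq μ ν)
    (hτ : 0 < τ) {ξ : E d → E d} (hξ : Continuous ξ) {C : ℝ} (hC : ∀ x, ‖ξ x‖ ≤ C) :
    ∫ z, inner ℝ (z.2 - z.1) (ξ z.2) ∂(γ : Measure (E d × E d)) =
      -(τ / 2) * ∫ z, fderiv ℝ W (z.1 - z.2) (ξ z.1 - ξ z.2) ∂(ν.meas.prod ν.meas) := by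
  set F : ℝ → ℝ := fun s =>
    1 / (2 * τ) * (∫ z, ‖z.1 - (z.2 + s • ξ z.2)‖ ^ 2 ∂(γ : Measure (E d × E d))) +
    1 / 2 * ∫ z, W (z.1 + s • ξ z.1 - (z.2 + s • ξ z.2)) ∂(ν.meas.prod ν.meas) with hF
  have hderiv := ((hasDerivAt_cost hγ hξ hC).const_mul (1 / (2 * τ))).add
    ((hW.hasDerivAt_energy (ν.meas.prod ν.meas) hξ hC).const_mul (1 / 2))
  have hF0 : F 0 = jkoFunctional W τ μ ν := by
    simp only [hF, zero_smul, add_zero, hopt, jkoFunctional, hW.energy_eq]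
    ring
  have hle : ∀ s, F 0 ≤ F s := by
    intro s
    have m2 : Measurable fun y : E d => y + s • ξ y := by fun_prop
    have m : Measurable fun z : E d × E d => (z.1, z.2 + s • ξ z.2) := by fun_prop
    have hfst : ((γ.map m.aemeasurable : ProbabilityMeasure (E d × E d)) :
        Measure (E d × E d)).map Prod.fst = μ.meas := by
      rw [ProbabilityMeasure.toMeasure_map, Measure.map_map measurable_fst m]
      exact hγ.1
    have hint : Integrable (fun z : E d × E d => ‖z.1 - z.2‖ ^ 2)
        ((γ.map m.aemeasurable : ProbabilityMeasure (E d × E d)) : Measure (E d × E d)) := by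
      rw [ProbabilityMeasure.toMeasure_map, integrable_map_measure (by fun_prop) m.aemeasurable]
      refine (((integrable_cost hγ).const_mul 2).add
        (integrable_const (2 * (|s| * C) ^ 2))).mono' (by fun_prop)
        (Eventually.of_forall fun z => ?_)
      rw [Function.comp_apply, Real.norm_of_nonneg (by positivity), ← sub_sub]
      refine (norm_sub_sq_le_two_mul _ _).trans (add_le_add le_rfl ?_)
      rw [norm_smul, Real.norm_eq_abs]
      have := hC z.2
      beta_reduce
      gcongr
    obtain ⟨ν', -, hν'⟩ := exists_mem_transportPlans μ _ hfst hint
    have hν'meas : ν'.meas = ν.meas.map fun y => y + s • ξ y := by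
      rw [← hν'.2, ← hγ.2, ProbabilityMeasure.toMeasure_map, Measure.map_map measurable_snd m,
        Measure.map_map m2 measurable_snd]
      rfl
    have hcost := wassersteinSq_le hν'
    rw [ProbabilityMeasure.toMeasure_map, integral_map m.aemeasurable (by fun_prop)] at hcost
    have henergy : energy W ν' = 1 / 2 *
        ∫ z, W (z.1 + s • ξ z.1 - (z.2 + s • ξ z.2)) ∂(ν.meas.prod ν.meas) := by
      have hcW := hW.continuous
      rw [hW.energy_eq, hν'meas, Measure.map_prod_map _ _ m2 m2,
        integral_map (by fun_prop) (by fun_prop)]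
      rfl
    rw [hF0]
    refine (hmin (mem_univ ν')).trans ?_
    rw [jkoFunctional, henergy, div_eq_inv_mul, ← one_div, hF]
    beta_reduce
    gcongr
  have hzero := IsLocalMin.hasDerivAt_eq_zero (f := F)
    (Eventually.of_forall hle : ∀ᶠ s in 𝓝 (0 : ℝ), F 0 ≤ F s) hderiv
  field_simp at hzero
  linarith

theorem weakIntegrand_eq (W φ : E d → ℝ) (z : E d × E d) : weakIntegrand W φ z =
    fderiv ℝ W (z.1 - z.2) (gradient φ z.1 - gradient φ z.2) := by
  rw [weakIntegrand, real_inner_comm, inner_gradient]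

theorem IsRegularPotential.continuous_weakIntegrand (hW : IsRegularPotential W B L)
    (hφ : ContDiff ℝ 1 φ) : Continuous (weakIntegrand W φ) := by
  have h1 := continuous_gradient hφ
  have h2 := continuous_gradient hW.contDiff
  unfold weakIntegrand
  fun_prop

theorem IsRegularPotential.norm_weakIntegrand_le (hW : IsRegularPotential W B L) {C : ℝ}
    (hC : ∀ x, ‖fderiv ℝ φ x‖ ≤ C) (z : E d × E d) : ‖weakIntegrand W φ z‖ ≤ L * (C + C) := by
  rw [weakIntegrand_eq]
  refine (ContinuousLinearMap.le_opNorm _ _).trans (mul_le_mul (hW.norm_fderiv_le _)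
    ((norm_sub_le _ _).trans (add_le_add ?_ ?_)) (norm_nonneg _) hW.grad_bound_nonneg) <;>
  · rw [norm_gradient]
    exact hC _

theorem exists_norm_fderiv_le (hφ : ContDiff ℝ 1 φ) (hs : HasCompactSupport φ) :
    ∃ C, 0 ≤ C ∧ ∀ x, ‖fderiv ℝ φ x‖ ≤ C := by
  obtain ⟨C, hC⟩ := (hφ.continuous_fderiv one_ne_zero).bounded_above_of_compact_support
    (hs.fderiv (𝕜 := ℝ))
  exact ⟨C, (norm_nonneg _).trans (hC 0), hC⟩

/-- First order Taylor expansion with a uniform remainder for `C¹_c` functions. -/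
theorem exists_taylor_bound (hφ : ContDiff ℝ 1 φ) (hs : HasCompactSupport φ) {η : ℝ} (hη : 0 < η) :
    ∃ K, 0 ≤ K ∧ ∀ x y, |φ y - φ x - fderiv ℝ φ y (y - x)| ≤ η * ‖x - y‖ + K * ‖x - y‖ ^ 2 := by
  obtain ⟨C, hC0, hC⟩ := exists_norm_fderiv_le hφ hs
  have huc : UniformContinuous (fderiv ℝ φ) :=
    (hs.fderiv (𝕜 := ℝ)).uniformContinuous_of_continuous (hφ.continuous_fderiv one_ne_zero)
  obtain ⟨δ, hδ, h⟩ := Metric.uniformContinuous_iff.1 huc η hη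
  have hd : Differentiable ℝ φ := hφ.differentiable one_ne_zero
  -- Within distance `δ` uniform continuity of the derivative gives the linear term. Beyond it, the
  -- crude bound `2C‖x - y‖` is absorbed into the quadratic term because `‖x - y‖ / δ ≥ 1`.
  refine ⟨(C + C) / δ, by positivity, fun x y => ?_⟩
  rcases lt_or_ge ‖x - y‖ δ with hxy | hxy
  · have h1 := Convex.norm_image_sub_le_of_norm_fderiv_le' (𝕜 := ℝ) (f := φ)
      (φ := fderiv ℝ φ y) (C := η) (s := Metric.ball y δ) (x := x) (y := y)
      (fun z _ => hd z) (fun z hz => by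
        rw [← dist_eq_norm]
        exact (h hz).le) (convex_ball y δ)
      (by rwa [Metric.mem_ball, dist_eq_norm]) (Metric.mem_ball_self hδ)
    rw [Real.norm_eq_abs, norm_sub_rev y x] at h1
    have : 0 ≤ (C + C) / δ * ‖x - y‖ ^ 2 := by positivity
    linarith
  · have h1 := Convex.norm_image_sub_le_of_norm_fderiv_le (𝕜 := ℝ) (f := φ) (C := C)
      (fun z _ => hd z) (fun z _ => hC z) convex_univ (mem_univ x) (mem_univ y)
    have h2 := (fderiv ℝ φ y).le_of_opNorm_le (hC y) (y - x)
    rw [norm_sub_rev y x] at h1 h2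
    have h3 : |φ y - φ x - fderiv ℝ φ y (y - x)| ≤ (C + C) * ‖x - y‖ := by
      have := norm_sub_le (φ y - φ x) (fderiv ℝ φ y (y - x))
      rw [Real.norm_eq_abs] at this
      linarith
    have h4 : (C + C) * ‖x - y‖ ≤ (C + C) / δ * ‖x - y‖ ^ 2 := by
      rw [div_mul_eq_mul_div, le_div_iff₀ hδ, mul_assoc, sq]
      gcongr
    have : 0 ≤ η * ‖x - y‖ := by positivity
    linarith

/-- One JKO step solves the weak equation up to a small error. -/
theorem IsRegularPotential.weak_step (hW : IsRegularPotential W B L) (hτ : 0 < τ)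
    (hmin : IsMinOn (jkoFunctional W τ μ) univ ν) (hφ : ContDiff ℝ 1 φ)
    (hs : HasCompactSupport φ) {η K : ℝ} (hη : 0 ≤ η) (hK : 0 ≤ K)
    (htaylor : ∀ x y, |φ y - φ x - fderiv ℝ φ y (y - x)| ≤ η * ‖x - y‖ + K * ‖x - y‖ ^ 2) :
    |(∫ x, φ x ∂ν.meas) - (∫ x, φ x ∂μ.meas) +
      τ / 2 * ∫ z, weakIntegrand W φ z ∂(ν.meas.prod ν.meas)| ≤
      η * (2 * L * τ) + K * (2 * L * τ) ^ 2 := by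
  obtain ⟨γ, hγ, hopt⟩ := exists_optimal_plan μ ν
  obtain ⟨C, hC0, hC⟩ := exists_norm_fderiv_le hφ hs
  obtain ⟨Cφ, hCφ⟩ := hφ.continuous.bounded_above_of_compact_support hs
  have hgc := continuous_gradient hφ
  have hφc := hφ.continuous
  have hg : ∀ x, ‖gradient φ x‖ ≤ C := fun x => by
    rw [norm_gradient]
    exact hC x
  have hEL := hW.euler_lagrange hmin hγ hopt hτ hgc hg
  simp_rw [← weakIntegrand_eq] at hEL
  obtain ⟨hi1, hsq⟩ := integral_norm_sub_sq_le hγ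
  have hi2 := integrable_cost hγ
  have hw := hW.wassersteinSq_le_of_isMinOn hτ hmin
  have hL := hW.grad_bound_nonneg
  rw [hopt] at hsq
  have hm : ∫ z, ‖z.1 - z.2‖ ∂(γ : Measure (E d × E d)) ≤ 2 * L * τ :=
    abs_le_of_sq_le_sq' (hsq.trans hw) (by positivity) |>.2
  have j1 : Integrable (fun z : E d × E d => φ z.2) (γ : Measure (E d × E d)) :=
    integrable_of_bounded (by fun_prop) (fun _ => hCφ _) _
  have j2 : Integrable (fun z : E d × E d => φ z.1) (γ : Measure (E d × E d)) :=
    integrable_of_bounded (by fun_prop) (fun _ => hCφ _) _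
  have j3 : Integrable (fun z : E d × E d => inner ℝ (z.2 - z.1) (gradient φ z.2))
      (γ : Measure (E d × E d)) := by
    refine (hi1.const_mul C).mono' (by fun_prop) (Eventually.of_forall fun z => ?_)
    refine (norm_inner_le_norm _ _).trans ?_
    rw [norm_sub_rev, mul_comm]
    exact mul_le_mul_of_nonneg_right (hg _) (norm_nonneg _)
  -- Taking `ξ = ∇φ` in the Euler–Lagrange identity replaces the drift by the linear Taylor term, so
  -- only the remainder of `φ` is left under the plan.
  have e : (∫ x, φ x ∂ν.meas) - (∫ x, φ x ∂μ.meas) +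
      τ / 2 * ∫ z, weakIntegrand W φ z ∂(ν.meas.prod ν.meas) =
      ∫ z, (φ z.2 - φ z.1 - inner ℝ (z.2 - z.1) (gradient φ z.2)) ∂(γ : Measure (E d × E d)) := by
    have j12 : Integrable (fun z : E d × E d => φ z.2 - φ z.1) (γ : Measure (E d × E d)) :=
      j1.sub j2
    rw [integral_sub j12 j3, integral_sub j1 j2, hEL,
      integral_fst_of_mem hγ hφc.stronglyMeasurable, integral_snd_of_mem hγ hφc.stronglyMeasurable]
    ring
  rw [e, ← Real.norm_eq_abs]
  have hb : Integrable (fun z : E d × E d => η * ‖z.1 - z.2‖ + K * ‖z.1 - z.2‖ ^ 2)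
      (γ : Measure (E d × E d)) := (hi1.const_mul η).add (hi2.const_mul K)
  refine (norm_integral_le_of_norm_le hb (Eventually.of_forall fun z => ?_)).trans ?_
  · rw [real_inner_comm, inner_gradient, Real.norm_eq_abs]
    exact htaylor z.1 z.2
  · rw [integral_add (hi1.const_mul η) (hi2.const_mul K), integral_const_mul, integral_const_mul,
      hopt]
    gcongr

end EulerLagrange

/-! ### Time integrals of piecewise constant interpolations -/

section Interpolation

variable {τ : ℝ} {r : ℕ → P2 d}

theorem interpolation_eq_of_mem_Ioc (hτ : 0 < τ) {n : ℕ} {s : ℝ}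
    (hs : s ∈ Ioc (n * τ) ((n + 1 : ℕ) * τ)) : interpolation τ r s = r (n + 1) := by
  have h : ⌈s / τ⌉₊ = n + 1 := by
    rw [Nat.ceil_eq_iff (Nat.succ_ne_zero n), Nat.succ_sub_one, lt_div_iff₀ hτ, div_le_iff₀ hτ]
    exact hs
  rw [interpolation, h]

variable {A : P2 d → ℝ} {CA : ℝ}

theorem intervalIntegrable_interpolation (hA : ∀ μ, |A μ| ≤ CA) (a b : ℝ) :
    IntervalIntegrable (fun s => A (interpolation τ r s)) volume a b := by
  refine (intervalIntegrable_const (c := CA)).mono_fun ?_ (Eventually.of_forall fun s =>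
    (hA _).trans (le_abs_self _))
  have h : Measurable fun s : ℝ => A (r ⌈s / τ⌉₊) :=
    (measurable_from_nat (f := fun n => A (r n))).comp
      (Nat.measurable_ceil.comp (measurable_id.div_const τ))
  exact h.aestronglyMeasurable

theorem integral_interpolation (hτ : 0 < τ) (hA : ∀ μ, |A μ| ≤ CA) (N : ℕ) :
    ∫ s in (0 : ℝ)..N * τ, A (interpolation τ r s) = τ * ∑ n ∈ Finset.range N, A (r (n + 1)) := by
  have h := intervalIntegral.sum_integral_adjacent_intervals (a := fun n : ℕ => (n : ℝ) * τ)
    (μ := volume) (n := N) (f := fun s => A (interpolation τ r s))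
    fun k _ => intervalIntegrable_interpolation hA _ _
  simp only [Nat.cast_zero, zero_mul] at h
  rw [← h, Finset.mul_sum]
  refine Finset.sum_congr rfl fun n _ => ?_
  have hle : (n : ℝ) * τ ≤ (n + 1 : ℕ) * τ := by gcongr; simp
  rw [intervalIntegral.integral_congr_ae (g := fun _ => A (r (n + 1)))]
  · rw [intervalIntegral.integral_const, smul_eq_mul]
    push_cast
    ring
  · refine Eventually.of_forall fun s hs => ?_
    rw [uIoc_of_le hle] at hs
    rw [interpolation_eq_of_mem_Ioc hτ hs]

end Interpolation

/-! ### Passage to the limit in the weak formulation -/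

section Limit

variable {W φ : E d → ℝ} {B L T : ℝ} {ρ₀ : P2 d}

theorem IsRegularPotential.abs_integral_weakIntegrand_le (hW : IsRegularPotential W B L) {C : ℝ}
    (hC : ∀ x, ‖fderiv ℝ φ x‖ ≤ C) (μ : P2 d) :
    |∫ z, weakIntegrand W φ z ∂(μ.meas.prod μ.meas)| ≤ L * (C + C) := by
  have h := norm_integral_le_of_norm_le_const (μ := μ.meas.prod μ.meas)
    (Eventually.of_forall fun z => hW.norm_weakIntegrand_le hC z)
  simpa using h

/-- The interpolation of a JKO sequence solves the weak equation up to an error that is small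
with the time step. -/
theorem IsRegularPotential.weak_interpolation (hW : IsRegularPotential W B L) {τ : ℝ} (hτ : 0 < τ)
    {r : ℕ → P2 d} (hr : IsJKOSequence W ρ₀ τ r) (hφ : ContDiff ℝ 1 φ)
    (hs : HasCompactSupport φ) {C : ℝ} (hC : ∀ x, ‖fderiv ℝ φ x‖ ≤ C) {η K : ℝ} (hη : 0 ≤ η)
    (hK : 0 ≤ K)
    (htaylor : ∀ x y, |φ y - φ x - fderiv ℝ φ y (y - x)| ≤ η * ‖x - y‖ + K * ‖x - y‖ ^ 2)
    {t : ℝ} (ht : 0 ≤ t) :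
    |(∫ x, φ x ∂(interpolation τ r t).meas) - (∫ x, φ x ∂ρ₀.meas) +
      1 / 2 * ∫ s in (0 : ℝ)..t, ∫ z, weakIntegrand W φ z
        ∂((interpolation τ r s).meas.prod (interpolation τ r s).meas)| ≤
      (t + τ) * (η * (2 * L) + K * (2 * L) ^ 2 * τ) + 1 / 2 * (L * (C + C) * τ) := by
  set A : P2 d → ℝ := fun μ => ∫ z, weakIntegrand W φ z ∂(μ.meas.prod μ.meas) with hA
  have hAb : ∀ μ, |A μ| ≤ L * (C + C) := hW.abs_integral_weakIntegrand_le hC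
  have hL := hW.grad_bound_nonneg
  set N := ⌈t / τ⌉₊ with hN
  have hN1 : t ≤ N * τ := (div_le_iff₀ hτ).1 (Nat.le_ceil _)
  have hN2 : N * τ ≤ t + τ := by
    have h1 := (Nat.ceil_lt_add_one (div_nonneg ht hτ.le)).le
    have h2 := mul_le_mul_of_nonneg_right h1 hτ.le
    rwa [add_mul, div_mul_cancel₀ _ hτ.ne', one_mul] at h2
  have htel : (∫ x, φ x ∂(r N).meas) - (∫ x, φ x ∂ρ₀.meas) =
      ∑ n ∈ Finset.range N, ((∫ x, φ x ∂(r (n + 1)).meas) - ∫ x, φ x ∂(r n).meas) := by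
    rw [Finset.sum_range_sub fun n => ∫ x, φ x ∂(r n).meas, hr.1]
  -- The `N` completed steps reach `Nτ`, which overshoots `t` by at most `τ`; the excess integral is
  -- an error of order `τ`.
  have hsplit : ∫ s in (0 : ℝ)..t, A (interpolation τ r s) =
      τ * (∑ n ∈ Finset.range N, A (r (n + 1))) -
        ∫ s in t..N * τ, A (interpolation τ r s) := by
    rw [← integral_interpolation hτ hAb N, eq_sub_iff_add_eq]
    exact intervalIntegral.integral_add_adjacent_intervals
      (intervalIntegrable_interpolation hAb _ _) (intervalIntegrable_interpolation hAb _ _)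
  have hrest : |∫ s in t..N * τ, A (interpolation τ r s)| ≤ L * (C + C) * τ := by
    have h := intervalIntegral.norm_integral_le_of_norm_le_const (a := t) (b := N * τ)
      (f := fun s => A (interpolation τ r s)) fun s _ => hAb _
    refine h.trans (mul_le_mul_of_nonneg_left ?_ ((abs_nonneg _).trans (hAb ρ₀)))
    rw [abs_of_nonneg (sub_nonneg.2 hN1)]
    linarith
  have hsum : |∑ n ∈ Finset.range N, ((∫ x, φ x ∂(r (n + 1)).meas) - (∫ x, φ x ∂(r n).meas) +
      τ / 2 * A (r (n + 1)))| ≤ N * (η * (2 * L * τ) + K * (2 * L * τ) ^ 2) := by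
    refine (Finset.abs_sum_le_sum_abs _ _).trans ((Finset.sum_le_sum fun n _ =>
      hW.weak_step hτ (hr.2 n) hφ hs hη hK htaylor).trans_eq ?_)
    rw [Finset.sum_const, Finset.card_range, nsmul_eq_mul]
  have hid : (∫ x, φ x ∂(interpolation τ r t).meas) - (∫ x, φ x ∂ρ₀.meas) +
      1 / 2 * ∫ s in (0 : ℝ)..t, A (interpolation τ r s) =
      (∑ n ∈ Finset.range N, ((∫ x, φ x ∂(r (n + 1)).meas) - (∫ x, φ x ∂(r n).meas) +
        τ / 2 * A (r (n + 1)))) - 1 / 2 * ∫ s in t..N * τ, A (interpolation τ r s) := by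
    rw [Finset.sum_add_distrib, ← htel, hsplit, ← Finset.mul_sum, interpolation]
    ring
  rw [hid]
  refine (abs_sub _ _).trans (add_le_add (hsum.trans ?_) ?_)
  · calc (N : ℝ) * (η * (2 * L * τ) + K * (2 * L * τ) ^ 2)
        = (N * τ) * (η * (2 * L) + K * (2 * L) ^ 2 * τ) := by ring
      _ ≤ _ := by gcongr
  · rw [abs_mul, abs_of_pos (by norm_num : (0 : ℝ) < 1 / 2)]
    gcongr

theorem IsRegularPotential.isWeakMeasureSolution (hW : IsRegularPotential W B L)
    {R : ℝ → ℕ → P2 d} (hR : ∀ τ, 0 < τ → IsJKOSequence W ρ₀ τ (R τ)) {ρ : ℝ → P2 d}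
    (hρ : IsJKOLimitCurve T R ρ) : IsWeakMeasureSolution W T ρ₀ ρ := by
  have hcont := hW.continuousOn_limit hR hρ
  obtain ⟨τ, hτ, hτ0, hlim⟩ := hρ
  have hAcont : ∀ φ : E d → ℝ, ContDiff ℝ 1 φ → HasCompactSupport φ →
      Continuous fun μ : ProbabilityMeasure (E d) =>
        ∫ z, weakIntegrand W φ z ∂((μ : Measure (E d)).prod (μ : Measure (E d))) := by
    intro φ hφ hs
    obtain ⟨C, -, hC⟩ := exists_norm_fderiv_le hφ hs
    exact continuous_integral_prod_self_of_bounded (hW.continuous_weakIntegrand hφ)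
      (hW.norm_weakIntegrand_le hC)
  refine ⟨hcont, fun φ hφ hs t ht => ?_, fun φ hφ hs t ht => ?_, fun φ hφ hs t ht => ?_⟩
  · obtain ⟨C, -, hC⟩ := exists_norm_fderiv_le hφ hs
    exact integrable_of_bounded (hW.continuous_weakIntegrand hφ) (hW.norm_weakIntegrand_le hC) _
  · refine ContinuousOn.intervalIntegrable ?_
    rw [uIcc_of_le ht.1]
    exact (hAcont φ hφ hs).comp_continuousOn (hcont.mono (Icc_subset_Icc_right ht.2))
  · obtain ⟨C, hC0, hC⟩ := exists_norm_fderiv_le hφ hs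
    obtain ⟨Cφ, hCφ⟩ := hφ.continuous.bounded_above_of_compact_support hs
    have hAb := fun μ : P2 d => hW.abs_integral_weakIntegrand_le hC μ
    have l1 : Tendsto (fun k => ∫ x, φ x ∂(interpolation (τ k) (R (τ k)) t).meas) atTop
        (𝓝 (∫ x, φ x ∂(ρ t).meas)) :=
      ((continuous_integral_of_bounded hφ.continuous hCφ).tendsto _).comp (hlim.tendsto ht)
    have l2 : Tendsto (fun k => ∫ s in (0 : ℝ)..t, ∫ z, weakIntegrand W φ z
        ∂((interpolation (τ k) (R (τ k)) s).meas.prod (interpolation (τ k) (R (τ k)) s).meas)) atTop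
        (𝓝 (∫ s in (0 : ℝ)..t, ∫ z, weakIntegrand W φ z ∂((ρ s).meas.prod (ρ s).meas))) := by
      refine intervalIntegral.tendsto_integral_filter_of_dominated_convergence
        (fun _ => L * (C + C)) (Eventually.of_forall fun k => ?_)
        (Eventually.of_forall fun k => Eventually.of_forall fun s _ => hAb _)
        intervalIntegrable_const (Eventually.of_forall fun s hs' => ?_)
      · have h : IntervalIntegrable _ _ _ _ :=
          intervalIntegrable_interpolation (τ := τ k) (r := R (τ k)) hAb 0 t
        exact h.def'.1
      · rw [uIoc_of_le ht.1] at hs'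
        exact ((hAcont φ hφ hs).tendsto _).comp (hlim.tendsto ⟨hs'.1.le, hs'.2.trans ht.2⟩)
    set D := (∫ x, φ x ∂(ρ t).meas) - (∫ x, φ x ∂ρ₀.meas) +
      1 / 2 * ∫ s in (0 : ℝ)..t, ∫ z, weakIntegrand W φ z ∂((ρ s).meas.prod (ρ s).meas) with hD
    have hDlim := ((l1.sub_const (∫ x, φ x ∂ρ₀.meas)).add (l2.const_mul (1 / 2))).abs
    -- With `η` fixed, the time step goes to zero first, which removes the term containing `K`, a
    -- constant that depends on `η`; only afterwards does `η` go to zero.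
    have hbound : ∀ η : ℝ, 0 < η → |D| ≤ t * (η * (2 * L)) := by
      intro η hη
      obtain ⟨K, hK, htaylor⟩ := exists_taylor_bound hφ hs hη
      have hc : Continuous fun u : ℝ =>
          (t + u) * (η * (2 * L) + K * (2 * L) ^ 2 * u) + 1 / 2 * (L * (C + C) * u) := by fun_prop
      have hlim' := (hc.tendsto 0).comp hτ0
      simp only [add_zero, mul_zero] at hlim'
      exact le_of_tendsto_of_tendsto' hDlim hlim' fun k =>
        hW.weak_interpolation (hτ k) (hR _ (hτ k)) hφ hs hC hη.le hK htaylor ht.1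
    have hc : Continuous fun η : ℝ => t * (η * (2 * L)) := by fun_prop
    have hlim0 := (hc.tendsto 0).mono_left (nhdsWithin_le_nhds (s := Ioi 0))
    simp only [zero_mul, mul_zero] at hlim0
    have hD0 : |D| ≤ 0 := ge_of_tendsto hlim0 (by
      filter_upwards [self_mem_nhdsWithin] with η hη
      exact hbound η hη)
    have hDz : D = 0 := abs_nonpos_iff.1 hD0
    linarith

end Limit

end NLIE

end

theorem theorem3p2 (d : ℕ) (V₁ : NLIE.E d → ℝ) (hV : NLIE.KernelAssumption V₁)
    (ε : ℝ) (hε : 0 < ε) (T : ℝ) (hT : 0 < T) (ρ₀ : NLIE.P2 d) (hρ₀ : ρ₀.InL2) :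
    ContDiffOn ℝ 1 (NLIE.Weps V₁ ε) {0}ᶜ ∧
    (∀ τ : ℝ, 0 < τ → ∃ r : ℕ → NLIE.P2 d, NLIE.IsJKOSequence (NLIE.Weps V₁ ε) ρ₀ τ r) ∧
    ∀ R : ℝ → ℕ → NLIE.P2 d,
      (∀ τ : ℝ, 0 < τ → NLIE.IsJKOSequence (NLIE.Weps V₁ ε) ρ₀ τ (R τ)) →
        (∃ ρ : ℝ → NLIE.P2 d, NLIE.IsACCurve T ρ ∧ NLIE.IsJKOLimitCurve T R ρ) ∧
        ∀ ρ : ℝ → NLIE.P2 d, NLIE.IsJKOLimitCurve T R ρ →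
          NLIE.IsWeakMeasureSolution (NLIE.Weps V₁ ε) T ρ₀ ρ := by
  obtain ⟨B, L, hW⟩ := hV.isRegularPotential_Weps hε
  exact ⟨hW.contDiff.contDiffOn, fun τ hτ => hW.exists_isJKOSequence hτ ρ₀, fun R hR =>
    ⟨hW.exists_limit_curve hR, fun ρ hρ => hW.isWeakMeasureSolution hR hρ⟩⟩
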